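/- Let $d\ge 1$, $0<s<1$, $p>1$, $q\ge 1$, $\tau\ge 1$, $0<a\le 1$, $\alpha,\beta,\gamma\in\mathbb{R}$, $\mu>1$ and $\Lambda>1$, with $\tau\le\mu$. Define $\sigma$ by $\gamma=a\sigma+(1-a)\beta$, and assume $$\frac1\tau+\frac\gamma d=a\Big(\frac1p+\frac{\alpha-s}{d}\Big)+(1-a)\Big(\frac1q+\frac\beta d\Big)\qquad\text{and}\qquad 0\le\alpha-\sigma\le s .$$ For a measurable function $u$ on $\mathbb{R}^d$ put $$\|u\|_{\dot W^{s,p,\alpha,\Lambda}(\mathbb{R}^d)}=\Big(\int_{\mathbb{R}^d}\int_{\mathbb{R}^d}\frac{|u(x)-u(y)|^p|x|^{\alpha p}}{|x-y|^{d+sp}}\,\chi_\Lambda(|x|,|y|)\,dx\,dy\Big)^{1/p}\in[0,\infty],$$ where $\chi_\Lambda(r_1,r_2)=1$ if $\Lambda^{-1}r_1\le r_2\le\Lambda r_1$ and $\chi_\Lambda(r_1,r_2)=0$ otherwise. Let $B_R$ be the open ball of radius $R$ centered at the origin, and let $\operatorname{supp}u$ be the complement of the largest open set on which $u=0$ almost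 everywhere. Then there exists a constant $C>0$ such that, for all real-valued $u\in L^1_{loc}(\mathbb{R}^d\setminus\{0\})$ and all $R_1,R_2>0$, the following hold. (i) If $\frac1\tau+\frac\gamma d=0$ and $\operatorname{supp}u\subset B_{R_2}$, then $$\Big(\int_{\mathbb{R}^d}\frac{|x|^{\gamma\tau}}{\ln^\mu(2R_2/|x|)}|u|^\tau\,dx\Big)^{1/\tau}\le C\,\|u\|^a_{\dot W^{s,p,\alpha,\Lambda}(\mathbb{R}^d)}\,\big\||x|^\beta u\big\|^{1-a}_{L^q(\mathbb{R}^d)} .$$ (ii) If $\frac1\tau+\frac\gamma d=0$ and $\operatorname{supp}u\cap B_{R_1}=\emptyset$, then $$\Big(\int_{\mathbb{R}^d}\frac{|x|^{\gamma\tau}}{\ln^\mu(2|x|/R_1)}|u|^\tau\,dx\Big)^{1/\tau}\le C\,\|u\|^a_{\dot W^{s,p,\alpha,\Lambda}(\mathbb{R}^d)}\,\big\||x|^\beta u\big\|^{1-a}_{L^q(\mathbb{R}^d)} .$$ Both sides are taken in $[0,\infty]$ with the conventions $\infty\cdot 0=0\cdot\infty=0$, $\infty^0=0^0=1$ and $\infty\le\infty$;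 the integrands on the left are understood to be $0$ where $u=0$. -/

import Mathlib

open MeasureTheory

noncomputable section

/-- The cut-off `χ_Λ(r₁, r₂)`: it is `1` if `Λ⁻¹ r₁ ≤ r₂ ≤ Λ r₁` and `0` otherwise. -/
def chiCut (Λ r₁ r₂ : ℝ) : ℝ :=
  open Classical in if Λ⁻¹ * r₁ ≤ r₂ ∧ r₂ ≤ Λ * r₁ then 1 else 0

/-- The localized weighted fractional semi-norm `‖g‖_{Ẇ^{s,p,α,Λ}(Ω)}`, with values in `[0, ∞]`. -/
def fracSeminorm {d : ℕ} (s p α Λ : ℝ) (Ω : Set (EuclideanSpace ℝ (Fin d)))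
    (g : EuclideanSpace ℝ (Fin d) → ℝ) : ENNReal :=
  (∫⁻ y in Ω, ∫⁻ x in Ω,
    ENNReal.ofReal (|g x - g y| ^ p * ‖x‖ ^ (α * p) / ‖x - y‖ ^ ((d : ℝ) + s * p)
      * chiCut Λ ‖x‖ ‖y‖)) ^ (1 / p)

/-- The support of a function that is given up to Lebesgue-null sets: the complement of the
largest open set on which the function vanishes almost everywhere. -/
def essSupport {d : ℕ} (u : EuclideanSpace ℝ (Fin d) → ℝ) : Set (EuclideanSpace ℝ (Fin d)) :=
  {x | ∀ U : Set (EuclideanSpace ℝ (Fin d)), IsOpen U → x ∈ U →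
    ¬ ∀ᵐ y ∂volume, y ∈ U → u y = 0}

end

/-! The case of interest is γτ = -d, in which |x|^(γτ) dx is scale invariant. Put ρ = √Λ and cover
the punctured space by the overlapping shells ρ^k R ≤ |x| < ρ^(k+2) R. Two points of one shell have
norms of ratio less than Λ, so χ_Λ = 1 for them, and every power weight is constant there up to a
bounded factor.

On one shell, a fractional Gagliardo–Nirenberg inequality (`exists_lintegral_oscillation_le`) bounds
the oscillation of u about its mean. It is applied with smoothness s' = s - (α - σ) in [0, s], the
value for which the balance condition becomes the unweighted one; all powers of R then cancel
(`exists_shellOscillation_le`). Since aτ/p + (1-a)τ/q ≥ 1, Hölder's inequality for series adds up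
the shells.

It remains to control the means. Consecutive shells overlap, so their means differ by at most their
oscillations. The mean vanishes on a shell off the support; from there one walks towards the origin
in (i) and towards infinity in (ii). After j steps the logarithmic factor is at most a multiple of
(j+1)^(-μ), and the discrete Hardy inequality `ENNReal.tsum_hardy_le`, where τ ≤ μ enters, adds up
the means.

The local inequality comes from averaging near x at scale r: |u(x) - c| ≤ C (r^s' G + r^(-d/τ) V)
for every r > 0, where G is a power of the Gagliardo slice at x times a power of R, and V is the L^τ
norm of u - c. Optimising in r, applying this to part of the power τ and integrating gives I ≤
I^(1-η) M for I = V^τ, and I is absorbed because it is finite. Finiteness is why u is first taken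
bounded; truncation removes this restriction. -/

open scoped ENNReal NNReal

/-! ### Discrete inequalities: Hardy and Hölder for series -/

theorem Real.rpow_neg_succ_le_sub {ν : ℝ} (hν : 1 < ν) (m : ℕ) :
    ((m : ℝ) + 1) ^ (-ν) ≤
      2 ^ ν / (ν - 1) * (((m : ℝ) + 1) ^ (1 - ν) - ((m : ℝ) + 2) ^ (1 - ν)) := by
  have hm : (0 : ℝ) < m + 1 := by positivity
  have hm2 : (0 : ℝ) < m + 2 := by positivity
  -- tangent line inequality for `x ↦ x ^ (1 - ν)` at `m + 2`
  have hx : (m + 2 : ℝ) * (1 + -1 / (m + 2)) = m + 1 := by field_simp; ring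
  have hb : 1 + (1 - ν) * (-1 / (m + 2 : ℝ)) ≤ (1 + -1 / (m + 2 : ℝ)) ^ (1 - ν) := by
    have h1 : (0 : ℝ) < 1 + -1 / (m + 2) := by
      rw [show (1 : ℝ) + -1 / (m + 2) = (m + 1) / (m + 2) by field_simp; ring]; positivity
    have h2 := Real.add_one_le_exp ((1 - ν) * Real.log (1 + -1 / (m + 2 : ℝ)))
    rw [mul_comm (1 - ν) (Real.log _), ← Real.rpow_def_of_pos h1] at h2
    have h3 := Real.log_le_sub_one_of_pos h1
    nlinarith
  have h4 : ((m : ℝ) + 1) ^ (1 - ν) =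
      ((m : ℝ) + 2) ^ (1 - ν) * (1 + -1 / (m + 2 : ℝ)) ^ (1 - ν) := by
    rw [← Real.mul_rpow hm2.le, hx]
    nlinarith [hx]
  have h5 : ((m : ℝ) + 2) ^ (1 - ν) = ((m : ℝ) + 2) ^ (-ν) * (m + 2) := by
    rw [show 1 - ν = -ν + 1 by ring, Real.rpow_add hm2, Real.rpow_one]
  have h6 : (ν - 1) * ((m : ℝ) + 2) ^ (-ν) ≤
      ((m : ℝ) + 1) ^ (1 - ν) - ((m : ℝ) + 2) ^ (1 - ν) := by
    have h7 := mul_le_mul_of_nonneg_left hb (Real.rpow_nonneg hm2.le (1 - ν))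
    rw [← h4] at h7
    have h8 : ((m : ℝ) + 2) ^ (1 - ν) * (1 + (1 - ν) * (-1 / (m + 2 : ℝ)))
        = ((m : ℝ) + 2) ^ (1 - ν) + (ν - 1) * ((m : ℝ) + 2) ^ (-ν) := by
      rw [h5]; field_simp; ring
    linarith
  have h9 : ((m : ℝ) + 1) ^ (-ν) ≤ 2 ^ ν * ((m : ℝ) + 2) ^ (-ν) := by
    have : (2 : ℝ) ^ ν = (1 / 2) ^ (-ν) := by
      rw [one_div, Real.inv_rpow (by norm_num), ← Real.rpow_neg (by norm_num), neg_neg]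
    rw [this, ← Real.mul_rpow (by norm_num) hm2.le]
    exact Real.rpow_le_rpow_of_nonpos (by positivity) (by linarith) (by linarith)
  have hν' : 0 < ν - 1 := by linarith
  calc ((m : ℝ) + 1) ^ (-ν) ≤ 2 ^ ν * ((m : ℝ) + 2) ^ (-ν) := h9
    _ = 2 ^ ν / (ν - 1) * ((ν - 1) * ((m : ℝ) + 2) ^ (-ν)) := by field_simp
    _ ≤ _ := by gcongr

theorem ENNReal.tsum_rpow_neg_tail_le {ν : ℝ} (hν : 1 < ν) (i : ℕ) :
    ∑' n : ℕ, ((((n + i : ℕ) : ℝ≥0∞) + 1) ^ (-ν)) ≤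
      ENNReal.ofReal (2 ^ ν / (ν - 1)) * ((i : ℝ≥0∞) + 1) ^ (1 - ν) := by
  have hcast : ∀ (m : ℕ) (e : ℝ), ((m : ℝ≥0∞) + 1) ^ e = ENNReal.ofReal (((m : ℝ) + 1) ^ e) := by
    intro m e
    rw [← ENNReal.ofReal_rpow_of_pos (by positivity), ENNReal.ofReal_add (by positivity) zero_le_one]
    simp
  have hν' : 0 < ν - 1 := by linarith
  apply ENNReal.tsum_le_of_sum_range_le
  intro N
  simp only [hcast]
  rw [← ENNReal.ofReal_sum_of_nonneg (fun _ _ => by positivity),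
    ← ENNReal.ofReal_mul (by positivity)]
  apply ENNReal.ofReal_le_ofReal
  have key : ∀ N : ℕ, ∑ n ∈ Finset.range N, (((n + i : ℕ) : ℝ) + 1) ^ (-ν) ≤
      2 ^ ν / (ν - 1) * (((i : ℝ) + 1) ^ (1 - ν) - (((N + i : ℕ) : ℝ) + 1) ^ (1 - ν)) := by
    intro N
    induction N with
    | zero => simp
    | succ N ih =>
      rw [Finset.sum_range_succ]
      have := Real.rpow_neg_succ_le_sub hν (N + i)
      have e : (((N + 1 + i : ℕ) : ℝ) + 1) = ((N + i : ℕ) : ℝ) + 2 := by push_cast; ring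
      rw [e]
      nlinarith
  refine (key N).trans ?_
  gcongr
  have : 0 ≤ (((N + i : ℕ) : ℝ) + 1) ^ (1 - ν) := by positivity
  linarith

theorem ENNReal.sum_range_rpow_neg_half_le (j : ℕ) :
    ∑ i ∈ Finset.range j, ((i : ℝ≥0∞) + 1) ^ (-(1 / 2) : ℝ) ≤ 2 * (j : ℝ≥0∞) ^ (1 / 2 : ℝ) := by
  have key : ∑ i ∈ Finset.range j, ((i : ℝ) + 1) ^ (-(1 / 2) : ℝ) ≤ 2 * Real.sqrt j := by
    induction j with
    | zero => simp
    | succ j ih =>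
      rw [Finset.sum_range_succ, Real.rpow_neg (by positivity), ← Real.sqrt_eq_rpow]
      push_cast
      set x := Real.sqrt j
      set y := Real.sqrt (j + 1)
      have hx : x ^ 2 = j := Real.sq_sqrt (by positivity)
      have hy : y ^ 2 = j + 1 := Real.sq_sqrt (by positivity)
      have hy0 : 0 < y := Real.sqrt_pos.2 (by positivity)
      have h1 : y⁻¹ ≤ 2 * (y - x) := by
        rw [inv_le_iff_one_le_mul₀ hy0]
        nlinarith [sq_nonneg (y - x)]
      linarith
  have := ENNReal.ofReal_le_ofReal key
  rw [ENNReal.ofReal_sum_of_nonneg (fun _ _ => by positivity),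
    ENNReal.ofReal_mul (by norm_num), Real.sqrt_eq_rpow,
    ← ENNReal.ofReal_rpow_of_nonneg (by positivity) (by norm_num)] at this
  convert! this using 2
  · rw [← ENNReal.ofReal_rpow_of_pos (by positivity), ENNReal.ofReal_add (by positivity) zero_le_one]
    simp
  · simp
  · simp

/-- A discrete Hardy inequality. -/
theorem ENNReal.tsum_hardy_le {τ μ : ℝ} (hτ : 1 ≤ τ) (hμ : 1 < μ) (hτμ : τ ≤ μ) :
    ∃ C : ℝ≥0, ∀ b E : ℕ → ℝ≥0∞, b 0 = 0 → (∀ j, b (j + 1) ≤ b j + E j) →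
      ∑' j : ℕ, ((j : ℝ≥0∞) + 1) ^ (-μ) * b (j + 1) ^ τ ≤ C * ∑' j, E j ^ τ := by
  have hτ0 : 0 < τ := by linarith
  -- Hölder with weights (i+1)^(-1/2) turns b^τ into a weighted sum of the E^τ, at the price of a
  -- factor of exponent κ in each of i and j. Summing over j first leaves (i+1)^(κ + 1 - ν), and κ +
  -- 1 - ν = τ - μ ≤ 0.
  set κ : ℝ := (τ - 1) / 2 with hκ
  set ν : ℝ := μ - κ with hνdef
  have hν : 1 < ν := by
    -- For τ > 1, τ ≤ μ gives ν ≥ (τ + 1)/2 > 1; for τ = 1 it is μ > 1 that is needed.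
    rcases hτ.eq_or_lt with h | h
    · rw [hνdef, hκ, ← h]; linarith
    · rw [hνdef, hκ]; linarith
  refine ⟨2 ^ (τ - 1) * Real.toNNReal (2 ^ ν / (ν - 1)), fun b E hb0 hb => ?_⟩
  have hw0 : ∀ i : ℕ, ((i : ℝ≥0∞) + 1) ≠ 0 := fun i => by simp
  have hwt : ∀ i : ℕ, ((i : ℝ≥0∞) + 1) ≠ ∞ := fun i => by finiteness
  have hsum : ∀ j, b j ≤ ∑ i ∈ Finset.range j, E i := by
    intro j
    induction j with
    | zero => simp [hb0]
    | succ j ih => rw [Finset.sum_range_succ]; exact (hb j).trans (by gcongr)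
  have hpow : ∀ j : ℕ, b (j + 1) ^ τ ≤ 2 ^ (τ - 1) * ((j : ℝ≥0∞) + 1) ^ κ *
      ∑ i ∈ Finset.range (j + 1), ((i : ℝ≥0∞) + 1) ^ κ * E i ^ τ := by
    intro j
    have h1 := ENNReal.inner_le_weight_mul_Lp_of_nonneg (Finset.range (j + 1)) hτ
      (fun i => ((i : ℝ≥0∞) + 1) ^ (-(1 / 2) : ℝ)) (fun i => ((i : ℝ≥0∞) + 1) ^ (1 / 2 : ℝ) * E i)
    have e1 : ∀ i : ℕ, ((i : ℝ≥0∞) + 1) ^ (-(1 / 2) : ℝ) * (((i : ℝ≥0∞) + 1) ^ (1 / 2 : ℝ) * E i)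
        = E i := by
      intro i
      rw [← mul_assoc, ← ENNReal.rpow_add _ _ (hw0 i) (hwt i)]; simp
    have e2 : ∀ i : ℕ, ((i : ℝ≥0∞) + 1) ^ (-(1 / 2) : ℝ) *
        (((i : ℝ≥0∞) + 1) ^ (1 / 2 : ℝ) * E i) ^ τ = ((i : ℝ≥0∞) + 1) ^ κ * E i ^ τ := by
      intro i
      rw [ENNReal.mul_rpow_of_nonneg _ _ hτ0.le, ← ENNReal.rpow_mul, ← mul_assoc,
        ← ENNReal.rpow_add _ _ (hw0 i) (hwt i)]
      congr 2; rw [hκ]; ring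
    simp only [e1, e2] at h1
    have h2 := (hsum (j + 1)).trans h1
    have h3 := ENNReal.rpow_le_rpow h2 hτ0.le
    rw [ENNReal.mul_rpow_of_nonneg _ _ hτ0.le, ← ENNReal.rpow_mul, ← ENNReal.rpow_mul,
      inv_mul_cancel₀ hτ0.ne', ENNReal.rpow_one] at h3
    refine h3.trans ?_
    gcongr
    rw [show (1 - τ⁻¹) * τ = τ - 1 by field_simp]
    have h4 := ENNReal.rpow_le_rpow (ENNReal.sum_range_rpow_neg_half_le (j + 1))
      (by linarith : 0 ≤ τ - 1)
    refine h4.trans (le_of_eq ?_)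
    rw [ENNReal.mul_rpow_of_nonneg _ _ (by linarith), ← ENNReal.rpow_mul]
    push_cast
    congr 2
    rw [hκ]; ring
  have htail : ∀ i : ℕ, ∑' j : ℕ, (if i < j + 1 then ((j : ℝ≥0∞) + 1) ^ (-ν) else 0) ≤
      ENNReal.ofReal (2 ^ ν / (ν - 1)) * ((i : ℝ≥0∞) + 1) ^ (1 - ν) := by
    intro i
    refine le_trans (le_of_eq ?_) (ENNReal.tsum_rpow_neg_tail_le hν i)
    rw [← ENNReal.summable.sum_add_tsum_nat_add' (k := i)]
    rw [Finset.sum_eq_zero, zero_add]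
    · exact tsum_congr fun n => if_pos (by omega)
    · intro n hn
      rw [Finset.mem_range] at hn
      exact if_neg (by omega)
  calc ∑' j : ℕ, ((j : ℝ≥0∞) + 1) ^ (-μ) * b (j + 1) ^ τ
      ≤ ∑' j : ℕ, ∑' i : ℕ, 2 ^ (τ - 1) * (((i : ℝ≥0∞) + 1) ^ κ * E i ^ τ) *
          (if i < j + 1 then ((j : ℝ≥0∞) + 1) ^ (-ν) else 0) := by
        refine ENNReal.tsum_le_tsum fun j => ?_
        calc ((j : ℝ≥0∞) + 1) ^ (-μ) * b (j + 1) ^ τ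
            ≤ ((j : ℝ≥0∞) + 1) ^ (-μ) * (2 ^ (τ - 1) * ((j : ℝ≥0∞) + 1) ^ κ *
              ∑ i ∈ Finset.range (j + 1), ((i : ℝ≥0∞) + 1) ^ κ * E i ^ τ) := by
              gcongr; exact hpow j
          _ = ∑ i ∈ Finset.range (j + 1), 2 ^ (τ - 1) * (((i : ℝ≥0∞) + 1) ^ κ * E i ^ τ) *
          (if i < j + 1 then ((j : ℝ≥0∞) + 1) ^ (-ν) else 0) := by
              rw [Finset.mul_sum, Finset.mul_sum]
              refine Finset.sum_congr rfl fun i hi => ?_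
              rw [if_pos (Finset.mem_range.1 hi), hνdef,
                show -(μ - κ) = -μ + κ by ring, ENNReal.rpow_add _ _ (hw0 j) (hwt j)]
              ring
          _ ≤ _ := ENNReal.sum_le_tsum _
    _ = ∑' i : ℕ, 2 ^ (τ - 1) * (((i : ℝ≥0∞) + 1) ^ κ * E i ^ τ) *
          ∑' j : ℕ, (if i < j + 1 then ((j : ℝ≥0∞) + 1) ^ (-ν) else 0) := by
        rw [ENNReal.tsum_comm]
        simp only [ENNReal.tsum_mul_left]
    _ ≤ ∑' i : ℕ, (2 ^ (τ - 1) * ENNReal.ofReal (2 ^ ν / (ν - 1))) * E i ^ τ := by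
        refine ENNReal.tsum_le_tsum fun i => ?_
        calc 2 ^ (τ - 1) * (((i : ℝ≥0∞) + 1) ^ κ * E i ^ τ) *
              ∑' j : ℕ, (if i < j + 1 then ((j : ℝ≥0∞) + 1) ^ (-ν) else 0)
            ≤ 2 ^ (τ - 1) * (((i : ℝ≥0∞) + 1) ^ κ * E i ^ τ) *
              (ENNReal.ofReal (2 ^ ν / (ν - 1)) * ((i : ℝ≥0∞) + 1) ^ (1 - ν)) := by
              gcongr; exact htail i
          _ = (2 ^ (τ - 1) * ENNReal.ofReal (2 ^ ν / (ν - 1))) * E i ^ τ *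
              ((i : ℝ≥0∞) + 1) ^ (κ + (1 - ν)) := by
              rw [ENNReal.rpow_add _ _ (hw0 i) (hwt i)]; ring
          _ ≤ (2 ^ (τ - 1) * ENNReal.ofReal (2 ^ ν / (ν - 1))) * E i ^ τ * 1 := by
              gcongr
              refine (ENNReal.rpow_le_rpow_of_exponent_le le_add_self
                (show κ + (1 - ν) ≤ 0 by rw [hνdef, hκ]; linarith)).trans ?_
              rw [ENNReal.rpow_zero]
          _ = _ := mul_one _
    _ = _ := by
        rw [ENNReal.tsum_mul_left]
        congr 1
        push_cast
        rw [ENNReal.coe_rpow_of_nonneg _ (by linarith)]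
        rfl

theorem ENNReal.tsum_rpow_le_rpow_tsum {ι : Type*} (f : ι → ℝ≥0∞) {t : ℝ} (ht : 1 ≤ t) :
    ∑' i, f i ^ t ≤ (∑' i, f i) ^ t := by
  have h : ∀ x : ℝ≥0∞, x ^ t = x * x ^ (t - 1) := fun x => by
    conv_lhs => rw [show t = 1 + (t - 1) by ring,
      ENNReal.rpow_add_of_nonneg _ _ zero_le_one (by linarith), ENNReal.rpow_one]
  rw [h, ← ENNReal.tsum_mul_right]
  refine ENNReal.tsum_le_tsum fun i => ?_
  rw [h]
  gcongr
  exact ENNReal.le_tsum i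

/-- Hölder's inequality for series, with exponents of sum at least one. -/
theorem ENNReal.tsum_rpow_mul_rpow_le {ι : Type*} [Countable ι] (P Q : ι → ℝ≥0∞) {A B : ℝ}
    (hA : 0 ≤ A) (hB : 0 ≤ B) (hAB : 1 ≤ A + B) :
    ∑' i, P i ^ A * Q i ^ B ≤ (∑' i, P i) ^ A * (∑' i, Q i) ^ B := by
  have ht : 0 < A + B := by linarith
  -- Hölder for the exponents normalised to sum one, read off from the counting measure. The
  -- remaining power A + B ≥ 1 is free because ℓ¹ embeds in ℓ^(A+B).
  have hol : ∑' i, P i ^ (A / (A + B)) * Q i ^ (B / (A + B)) ≤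
      (∑' i, P i) ^ (A / (A + B)) * (∑' i, Q i) ^ (B / (A + B)) := by
    let _ : MeasurableSpace ι := ⊤
    have := ENNReal.lintegral_mul_norm_pow_le (μ := Measure.count) (f := P) (g := Q)
      (by measurability) (by measurability) (p := A / (A + B)) (q := B / (A + B))
      (by positivity) (by positivity) (by field_simp)
    simpa [MeasureTheory.lintegral_count] using this
  have e : ∀ (x y : ℝ≥0∞), x ^ A * y ^ B = (x ^ (A / (A + B)) * y ^ (B / (A + B))) ^ (A + B) := by
    intro x y
    rw [ENNReal.mul_rpow_of_nonneg _ _ ht.le, ← ENNReal.rpow_mul, ← ENNReal.rpow_mul]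
    congr 2 <;> field_simp
  simp only [e]
  exact (ENNReal.tsum_rpow_le_rpow_tsum _ hAB).trans (ENNReal.rpow_le_rpow hol ht.le)

/-! ### Geometry of shells and averages -/

/-- The spherical shell of the points whose norm lies in `[r, R)`. -/
def normShell (d : ℕ) (r R : ℝ) : Set (EuclideanSpace ℝ (Fin d)) := {x | r ≤ ‖x‖ ∧ ‖x‖ < R}

theorem measurableSet_normShell (d : ℕ) (r R : ℝ) : MeasurableSet (normShell d r R) :=
  (measurableSet_le measurable_const measurable_norm).inter
    (measurableSet_lt measurable_norm measurable_const)

theorem normShell_subset_ball (d : ℕ) (r R : ℝ) : normShell d r R ⊆ Metric.ball 0 R :=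
  fun x hx => by simpa using hx.2

theorem volume_normShell_ne_top (d : ℕ) (r R : ℝ) : volume (normShell d r R) ≠ ∞ :=
  ((measure_mono (normShell_subset_ball d r R)).trans_lt measure_ball_lt_top).ne

theorem volume_ball_eq_unit (d : ℕ) (z : EuclideanSpace ℝ (Fin d)) {h : ℝ} (hh : 0 < h) :
    volume (Metric.ball z h) = ENNReal.ofReal h ^ (d : ℝ) *
      volume (Metric.ball (0 : EuclideanSpace ℝ (Fin d)) 1) := by
  rw [Measure.addHaar_ball_of_pos _ _ hh, finrank_euclideanSpace_fin, ENNReal.rpow_natCast,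
    ENNReal.ofReal_pow hh.le]

/-- Moving x radially, by at most h, brings its norm into [r + h, R - h]; a ball of radius h about
the new point stays in the shell. This plays the role of an interior cone condition, uniformly in x.
-/
theorem exists_ball_subset_normShell {d : ℕ} {r R h : ℝ} (hr : 0 < r) (hh : 0 < h)
    (hR : 2 * h ≤ R - r) {x : EuclideanSpace ℝ (Fin d)} (hx : x ∈ normShell d r R) :
    ∃ z, Metric.ball z h ⊆ normShell d r R ∧ Metric.ball z h ⊆ Metric.ball x (2 * h) := by
  obtain ⟨hx1, hx2⟩ := hx
  have hx0 : 0 < ‖x‖ := hr.trans_le hx1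
  obtain ⟨m, hm1, hm2, hm3, hm4⟩ : ∃ m : ℝ, r + h ≤ m ∧ m ≤ R - h ∧ m - ‖x‖ ≤ h ∧ ‖x‖ - m ≤ h := by
    rcases le_total ‖x‖ (r + h) with h1 | h1
    · exact ⟨r + h, by linarith, by linarith, by linarith, by linarith⟩
    · rcases le_total ‖x‖ (R - h) with h2 | h2
      · exact ⟨‖x‖, by linarith, by linarith, by linarith, by linarith⟩
      · exact ⟨R - h, by linarith, by linarith, by linarith, by linarith⟩
  have hm0 : 0 < m := by linarith
  have hz : ‖(m / ‖x‖) • x‖ = m := by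
    rw [norm_smul, Real.norm_of_nonneg (by positivity)]; field_simp
  have hzx : ‖(m / ‖x‖) • x - x‖ ≤ h := by
    have : (m / ‖x‖) • x - x = ((m - ‖x‖) / ‖x‖) • x := by
      rw [sub_div, sub_smul, div_self hx0.ne', one_smul]
    rw [this, norm_smul, Real.norm_eq_abs, abs_div, abs_norm, div_mul_cancel₀ _ hx0.ne']
    exact abs_le.2 ⟨by linarith, hm3⟩
  refine ⟨(m / ‖x‖) • x, fun y hy => ?_, fun y hy => ?_⟩
  · rw [mem_ball_iff_norm] at hy
    have h1 := norm_sub_norm_le y ((m / ‖x‖) • x)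
    have h2 := norm_sub_norm_le ((m / ‖x‖) • x) y
    rw [norm_sub_rev] at h2
    rw [hz] at h1 h2
    exact ⟨by linarith, by linarith⟩
  · rw [mem_ball_iff_norm] at hy ⊢
    calc ‖y - x‖ ≤ ‖y - (m / ‖x‖) • x‖ + ‖(m / ‖x‖) • x - x‖ := norm_sub_le_norm_sub_add_norm_sub ..
      _ < 2 * h := by linarith

theorem lintegral_le_measure_rpow_mul {X : Type*} [MeasurableSpace X] {ν : Measure X}
    {f : X → ℝ≥0∞} (hf : AEMeasurable f ν) {m : ℝ} (hm : 1 ≤ m) :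
    ∫⁻ x, f x ∂ν ≤ ν Set.univ ^ (1 - 1 / m) * (∫⁻ x, f x ^ m ∂ν) ^ (1 / m) := by
  have hm0 : 0 < m := by linarith
  have := ENNReal.lintegral_mul_norm_pow_le (μ := ν) (f := fun x => f x ^ m) (g := fun _ => 1)
    (hf.pow_const _) aemeasurable_const (p := 1 / m) (q := 1 - 1 / m) (by positivity)
    (by rw [sub_nonneg, div_le_one hm0]; exact hm) (by ring)
  simp only [← ENNReal.rpow_mul, mul_one_div_cancel hm0.ne', ENNReal.rpow_one, ENNReal.one_rpow,
    mul_one, lintegral_one] at this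
  rwa [mul_comm]

theorem enorm_setAverage_sub_mul_le {X : Type*} [MeasurableSpace X] {ν : Measure X} {S : Set X}
    (h0 : ν S ≠ 0) (ht : ν S ≠ ∞) {u : X → ℝ} (hu : IntegrableOn u S ν) (k : ℝ) :
    ‖(⨍ y in S, u y ∂ν) - k‖ₑ * ν S ≤ ∫⁻ y in S, ‖u y - k‖ₑ ∂ν := by
  have h1 : ∫ y in S, (u y - k) ∂ν = ((⨍ y in S, u y ∂ν) - k) * ν.real S := by
    rw [integral_sub hu (integrableOn_const ht), setIntegral_const, setAverage_eq, smul_eq_mul,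
      smul_eq_mul, sub_mul, mul_comm k]
    have : ν.real S ≠ 0 := by rw [measureReal_def]; exact ENNReal.toReal_ne_zero.2 ⟨h0, ht⟩
    field_simp
  have h2 := enorm_integral_le_lintegral_enorm (μ := ν.restrict S) (fun y => u y - k)
  rw [h1, enorm_mul] at h2
  have h3 : ‖ν.real S‖ₑ = ν S := by
    rw [Real.enorm_eq_ofReal measureReal_nonneg, measureReal_def, ENNReal.ofReal_toReal ht]
  rwa [h3] at h2

/-! ### Pointwise oscillation bounds by the Gagliardo slice -/

section Kernel

variable {d : ℕ}

/-- The inner integral of the unweighted Gagliardo energy over `S`. -/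
noncomputable def gagliardoSlice (s p : ℝ) (S : Set (EuclideanSpace ℝ (Fin d)))
    (u : EuclideanSpace ℝ (Fin d) → ℝ) (x : EuclideanSpace ℝ (Fin d)) : ℝ≥0∞ :=
  ∫⁻ y in S, ENNReal.ofReal (|u y - u x| ^ p / ‖y - x‖ ^ ((d : ℝ) + s * p))

theorem measurable_gagliardoSlice (s p : ℝ) (S : Set (EuclideanSpace ℝ (Fin d)))
    {u : EuclideanSpace ℝ (Fin d) → ℝ} (hu : Measurable u) :
    Measurable (gagliardoSlice s p S u) := by
  unfold gagliardoSlice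
  apply Measurable.lintegral_prod_right'
    (f := fun z : EuclideanSpace ℝ (Fin d) × EuclideanSpace ℝ (Fin d) =>
      ENNReal.ofReal (|u z.2 - u z.1| ^ p / ‖z.2 - z.1‖ ^ ((d : ℝ) + s * p)))
  fun_prop

/-- Hölder raises the integrand to the power p, and ‖y - x‖ ≤ δ allows the singular kernel to be
inserted at the cost of δ^(d + sp). -/
theorem setLIntegral_enorm_sub_le_gagliardoSlice {s p δ : ℝ} (hs : 0 < s) (hp : 1 < p)
    {S B : Set (EuclideanSpace ℝ (Fin d))} (hB : MeasurableSet B) (hBS : B ⊆ S)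
    {u : EuclideanSpace ℝ (Fin d) → ℝ} (hu : Measurable u) {x : EuclideanSpace ℝ (Fin d)}
    (hδ : ∀ y ∈ B, ‖y - x‖ ≤ δ) :
    ∫⁻ y in B, ‖u y - u x‖ₑ ≤ volume B ^ (1 - 1 / p) *
      (ENNReal.ofReal δ ^ ((d : ℝ) / p + s) * gagliardoSlice s p S u x ^ (1 / p)) := by
  have hp0 : 0 < p := by linarith
  refine (lintegral_le_measure_rpow_mul (by fun_prop) hp.le).trans ?_
  rw [Measure.restrict_apply_univ]
  gcongr
  have h1 : ∫⁻ y in B, ‖u y - u x‖ₑ ^ p ≤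
      ENNReal.ofReal δ ^ ((d : ℝ) + s * p) * gagliardoSlice s p S u x := by
    calc ∫⁻ y in B, ‖u y - u x‖ₑ ^ p
        ≤ ∫⁻ y in B, ENNReal.ofReal δ ^ ((d : ℝ) + s * p) *
          ENNReal.ofReal (|u y - u x| ^ p / ‖y - x‖ ^ ((d : ℝ) + s * p)) := by
          refine setLIntegral_mono' hB fun y hy => ?_
          rw [Real.enorm_eq_ofReal_abs, ENNReal.ofReal_rpow_of_nonneg (abs_nonneg _) hp0.le]
          rcases eq_or_ne y x with rfl | hyx
          · simp [Real.zero_rpow hp0.ne']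
          have hn : 0 < ‖y - x‖ := norm_pos_iff.2 (sub_ne_zero.2 hyx)
          have hδ0 : 0 < δ := hn.trans_le (hδ y hy)
          rw [ENNReal.ofReal_rpow_of_pos hδ0, ← ENNReal.ofReal_mul (by positivity)]
          apply ENNReal.ofReal_le_ofReal
          have : 1 ≤ δ ^ ((d : ℝ) + s * p) / ‖y - x‖ ^ ((d : ℝ) + s * p) := by
            rw [one_le_div (by positivity)]
            exact Real.rpow_le_rpow hn.le (hδ y hy) (by positivity)
          calc |u y - u x| ^ p = |u y - u x| ^ p * 1 := (mul_one _).symm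
            _ ≤ |u y - u x| ^ p * (δ ^ ((d : ℝ) + s * p) / ‖y - x‖ ^ ((d : ℝ) + s * p)) := by gcongr
            _ = _ := by ring
      _ = ENNReal.ofReal δ ^ ((d : ℝ) + s * p) * ∫⁻ y in B,
          ENNReal.ofReal (|u y - u x| ^ p / ‖y - x‖ ^ ((d : ℝ) + s * p)) := by
          rw [lintegral_const_mul _ (by fun_prop)]
      _ ≤ _ := by
          gcongr
          exact lintegral_mono_set hBS
  refine (ENNReal.rpow_le_rpow h1 (by positivity)).trans (le_of_eq ?_)
  rw [ENNReal.mul_rpow_of_nonneg _ _ (by positivity), ← ENNReal.rpow_mul]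
  congr 2
  field_simp

theorem ENNReal.le_rpow_neg_mul_of_mul_le {X M Y : ℝ≥0∞} {e : ℝ} (h0 : M ≠ 0) (ht : M ≠ ∞)
    (h : X * M ≤ M ^ (1 - e) * Y) : X ≤ M ^ (-e) * Y := by
  rw [← ENNReal.le_div_iff_mul_le (Or.inl h0) (Or.inl ht)] at h
  refine h.trans (le_of_eq ?_)
  rw [ENNReal.div_eq_inv_mul, ← mul_assoc, ← ENNReal.rpow_neg_one, ← ENNReal.rpow_add _ _ h0 ht]
  congr 2
  ring

/-- Averaging |u x - c| ≤ |u y - u x| + |u y - c| over y in B: the first term is controlled by the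
Gagliardo slice, the second by Hölder. -/
theorem enorm_sub_le_gagliardoSlice_add {s p m δ : ℝ} (hs : 0 < s) (hp : 1 < p) (hm : 1 ≤ m)
    {S B : Set (EuclideanSpace ℝ (Fin d))} (hB : MeasurableSet B) (hBS : B ⊆ S)
    (h0 : volume B ≠ 0) (ht : volume B ≠ ∞)
    {u : EuclideanSpace ℝ (Fin d) → ℝ} (hu : Measurable u) {x : EuclideanSpace ℝ (Fin d)}
    (hδ : ∀ y ∈ B, ‖y - x‖ ≤ δ) (c : ℝ) :
    ‖u x - c‖ₑ ≤ volume B ^ (-(1 / p)) *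
        (ENNReal.ofReal δ ^ ((d : ℝ) / p + s) * gagliardoSlice s p S u x ^ (1 / p)) +
      volume B ^ (-(1 / m)) * (∫⁻ y in S, ‖u y - c‖ₑ ^ m) ^ (1 / m) := by
  have hm0 : 0 < m := by linarith
  have h1 : ‖u x - c‖ₑ * volume B ≤ (∫⁻ y in B, ‖u y - u x‖ₑ) + ∫⁻ y in B, ‖u y - c‖ₑ := by
    rw [← lintegral_add_left (by fun_prop), ← setLIntegral_const]
    refine lintegral_mono fun y => ?_
    calc ‖u x - c‖ₑ = ‖(u x - u y) + (u y - c)‖ₑ := by congr 1; ring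
      _ ≤ ‖u x - u y‖ₑ + ‖u y - c‖ₑ := enorm_add_le _ _
      _ = _ := by rw [← enorm_neg, neg_sub]
  have h2 : ∫⁻ y in B, ‖u y - c‖ₑ ≤
      volume B ^ (1 - 1 / m) * (∫⁻ y in S, ‖u y - c‖ₑ ^ m) ^ (1 / m) := by
    refine (lintegral_le_measure_rpow_mul (by fun_prop) hm).trans ?_
    rw [Measure.restrict_apply_univ]
    gcongr
  have h3 := setLIntegral_enorm_sub_le_gagliardoSlice hs hp hB hBS hu hδ
  have e : ∀ e : ℝ, volume B ^ (1 - e) = volume B ^ (-e) * volume B := fun e => by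
    rw [show 1 - e = -e + 1 by ring, ENNReal.rpow_add _ _ h0 ht, ENNReal.rpow_one]
  rw [← ENNReal.mul_le_mul_iff_left h0 ht]
  refine h1.trans ((add_le_add h3 h2).trans (le_of_eq ?_))
  rw [e, e]
  ring

theorem enorm_sub_setAverage_le_gagliardoSlice {s p δ : ℝ} (hs : 0 < s) (hp : 1 < p)
    {S : Set (EuclideanSpace ℝ (Fin d))} (hS : MeasurableSet S)
    (h0 : volume S ≠ 0) (ht : volume S ≠ ∞)
    {u : EuclideanSpace ℝ (Fin d) → ℝ} (hu : Measurable u) (hui : IntegrableOn u S)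
    {x : EuclideanSpace ℝ (Fin d)} (hδ : ∀ y ∈ S, ‖y - x‖ ≤ δ) :
    ‖u x - ⨍ y in S, u y‖ₑ ≤ volume S ^ (-(1 / p)) *
        (ENNReal.ofReal δ ^ ((d : ℝ) / p + s) * gagliardoSlice s p S u x ^ (1 / p)) := by
  apply ENNReal.le_rpow_neg_mul_of_mul_le h0 ht
  rw [← enorm_neg, neg_sub]
  exact (enorm_setAverage_sub_mul_le h0 ht hui _).trans
    (setLIntegral_enorm_sub_le_gagliardoSlice hs hp hS subset_rfl hu hδ)

theorem volume_unitBall_ne_zero : volume (Metric.ball (0 : EuclideanSpace ℝ (Fin d)) 1) ≠ 0 :=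
  (Metric.measure_ball_pos _ _ one_pos).ne'

theorem volume_unitBall_ne_top : volume (Metric.ball (0 : EuclideanSpace ℝ (Fin d)) 1) ≠ ∞ :=
  measure_ball_lt_top.ne

theorem normShell_nonempty (hd : 1 ≤ d) {r R : ℝ} (hr : 0 ≤ r) (hR : r < R) :
    (normShell d r R).Nonempty := by
  refine ⟨EuclideanSpace.single ⟨0, hd⟩ r, ?_⟩
  simp [normShell, abs_of_nonneg hr, hR]

theorem le_volume_normShell (hd : 1 ≤ d) {l R : ℝ} (hl : 1 < l) (hR : 0 < R) :
    (ENNReal.ofReal ((l - 1) / 2) * ENNReal.ofReal R) ^ (d : ℝ) *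
      volume (Metric.ball (0 : EuclideanSpace ℝ (Fin d)) 1) ≤ volume (normShell d R (l * R)) := by
  have hl0 : 0 < (l - 1) / 2 := by linarith
  obtain ⟨x, hx⟩ := normShell_nonempty hd hR.le (show R < l * R by nlinarith)
  obtain ⟨z, hz, -⟩ := exists_ball_subset_normShell (h := (l - 1) / 2 * R) hR (by positivity)
    (by linarith) hx
  rw [← ENNReal.ofReal_mul hl0.le, ← volume_ball_eq_unit d z (by positivity)]
  exact measure_mono hz

/-- Pointwise control of the oscillation on a shell by the Gagliardo slice and an `L^m` norm,
at every scale `r`. -/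
theorem exists_enorm_sub_average_le (hd : 1 ≤ d) {s s' p m l : ℝ} (hs : 0 < s) (hp : 1 < p)
    (hm : 1 ≤ m) (hl : 1 < l) (hs'0 : 0 ≤ s') (hs's : s' ≤ s) :
    ∃ C : ℝ≥0∞, C ≠ ∞ ∧ ∀ R : ℝ, 0 < R → ∀ u : EuclideanSpace ℝ (Fin d) → ℝ, Measurable u →
      IntegrableOn u (normShell d R (l * R)) → ∀ x ∈ normShell d R (l * R), ∀ r : ℝ, 0 < r →
      ‖u x - ⨍ y in normShell d R (l * R), u y‖ₑ ≤
        C * (ENNReal.ofReal r ^ s' * (ENNReal.ofReal R ^ (s - s') *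
            gagliardoSlice s p (normShell d R (l * R)) u x ^ (1 / p)) +
          ENNReal.ofReal r ^ (-((d : ℝ) / m)) *
            (∫⁻ y in normShell d R (l * R),
              ‖u y - ⨍ z in normShell d R (l * R), u z‖ₑ ^ m) ^ (1 / m)) := by
  have hp0 : 0 < p := by linarith
  have hm0 : 0 < m := by linarith
  have hl0 : 0 < (l - 1) / 2 := by linarith
  set ω := volume (Metric.ball (0 : EuclideanSpace ℝ (Fin d)) 1) with hω
  have hω0 : ω ≠ 0 := volume_unitBall_ne_zero
  have hωt : ω ≠ ∞ := volume_unitBall_ne_top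
  set h₀ := ENNReal.ofReal ((l - 1) / 2) with hh₀
  have hh0 : h₀ ≠ 0 := by simpa [hh₀] using hl
  have hht : h₀ ≠ ∞ := ENNReal.ofReal_ne_top
  -- The first two summands serve the small scales, the last one the large scales.
  refine ⟨ω ^ (-(1 / p)) * 2 ^ ((d : ℝ) / p + s) * h₀ ^ (s - s') + ω ^ (-(1 / m)) +
    ω ^ (-(1 / p)) * h₀ ^ (-((d : ℝ) / p)) * ENNReal.ofReal (2 * l) ^ ((d : ℝ) / p + s) *
      h₀ ^ (-s'), ?_, ?_⟩
  · have t : ∀ {x : ℝ≥0∞} {e : ℝ}, x ≠ 0 → x ≠ ∞ → x ^ e ≠ ∞ := fun h h' =>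
      ENNReal.rpow_ne_top_of_ne_zero h h'
    have h2 : ENNReal.ofReal (2 * l) ^ ((d : ℝ) / p + s) ≠ ∞ :=
      ENNReal.rpow_ne_top_of_nonneg (by positivity) ENNReal.ofReal_ne_top
    have h3 : (2 : ℝ≥0∞) ^ ((d : ℝ) / p + s) ≠ ∞ :=
      ENNReal.rpow_ne_top_of_nonneg (by positivity) (by simp)
    simp only [ne_eq, ENNReal.add_eq_top, not_or]
    exact ⟨⟨ENNReal.mul_ne_top (ENNReal.mul_ne_top (t hω0 hωt) h3) (t hh0 hht), t hω0 hωt⟩,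
      ENNReal.mul_ne_top (ENNReal.mul_ne_top (ENNReal.mul_ne_top (t hω0 hωt) (t hh0 hht)) h2)
        (t hh0 hht)⟩
  intro R hR u hu hui x hx r hr
  set S := normShell d R (l * R) with hS
  set c := ⨍ y in S, u y
  set V := (∫⁻ y in S, ‖u y - c‖ₑ ^ m) ^ (1 / m)
  set K := gagliardoSlice s p S u x ^ (1 / p)
  set ρ := ENNReal.ofReal r with hρ
  set Q := ENNReal.ofReal R with hQ
  have hρ0 : ρ ≠ 0 := by simpa [hρ] using hr
  have hρt : ρ ≠ ∞ := ENNReal.ofReal_ne_top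
  have hQ0 : Q ≠ 0 := by simpa [hQ] using hR
  have hQt : Q ≠ ∞ := ENNReal.ofReal_ne_top
  -- Up to half the width of the shell, a ball of radius r near x fits inside, and r^(s-s') is
  -- traded for R^(s-s'). Beyond it, averaging over the whole shell compares u x with the mean
  -- itself, so no L^m term appears, and R^s' is bounded by a multiple of r^s'.
  rcases le_total r ((l - 1) / 2 * R) with hrR | hrR
  · obtain ⟨z, hz1, hz2⟩ := exists_ball_subset_normShell (h := r) hR hr (by linarith) hx
    have h1 := enorm_sub_le_gagliardoSlice_add hs hp hm measurableSet_ball hz1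
      (Metric.measure_ball_pos _ _ hr).ne' measure_ball_lt_top.ne hu (x := x) (δ := 2 * r)
      (fun y hy => (mem_ball_iff_norm.1 (hz2 hy)).le) c
    rw [volume_ball_eq_unit d z hr, ENNReal.ofReal_mul (by norm_num), ENNReal.ofReal_ofNat] at h1
    rw [← hω, ← hρ] at h1
    refine h1.trans ?_
    have hρd0 : ρ ^ (d : ℝ) ≠ 0 := by simp [hρ0]
    rw [ENNReal.mul_rpow_of_ne_zero hρd0 hω0, ENNReal.mul_rpow_of_ne_zero hρd0 hω0,
      ENNReal.mul_rpow_of_ne_zero (by norm_num) hρ0, ← ENNReal.rpow_mul, ← ENNReal.rpow_mul]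
    have e1 : ρ ^ ((d : ℝ) * -(1 / p)) * ρ ^ ((d : ℝ) / p + s) = ρ ^ s' * ρ ^ (s - s') := by
      rw [← ENNReal.rpow_add _ _ hρ0 hρt, ← ENNReal.rpow_add _ _ hρ0 hρt]
      congr 1; ring
    have e2 : ρ ^ (s - s') ≤ h₀ ^ (s - s') * Q ^ (s - s') := by
      rw [← ENNReal.mul_rpow_of_nonneg _ _ (by linarith), hh₀, hQ, ← ENNReal.ofReal_mul hl0.le]
      exact ENNReal.rpow_le_rpow (ENNReal.ofReal_le_ofReal hrR) (by linarith)
    have e3 : (d : ℝ) * -(1 / m) = -((d : ℝ) / m) := by ring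
    rw [mul_add]
    apply add_le_add
    · calc ρ ^ ((d : ℝ) * -(1 / p)) * ω ^ (-(1 / p)) *
            (2 ^ ((d : ℝ) / p + s) * ρ ^ ((d : ℝ) / p + s) * K)
          = ω ^ (-(1 / p)) * 2 ^ ((d : ℝ) / p + s) *
            (ρ ^ ((d : ℝ) * -(1 / p)) * ρ ^ ((d : ℝ) / p + s)) * K := by ring
        _ = ω ^ (-(1 / p)) * 2 ^ ((d : ℝ) / p + s) * (ρ ^ s' * ρ ^ (s - s')) * K := by rw [e1]
        _ ≤ ω ^ (-(1 / p)) * 2 ^ ((d : ℝ) / p + s) *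
            (ρ ^ s' * (h₀ ^ (s - s') * Q ^ (s - s'))) * K := by gcongr
        _ = (ω ^ (-(1 / p)) * 2 ^ ((d : ℝ) / p + s) * h₀ ^ (s - s')) *
            (ρ ^ s' * (Q ^ (s - s') * K)) := by ring
        _ ≤ _ := by gcongr; rw [add_assoc]; exact le_self_add
    · rw [e3]
      calc ρ ^ (-((d : ℝ) / m)) * ω ^ (-(1 / m)) * V
          = ω ^ (-(1 / m)) * (ρ ^ (-((d : ℝ) / m)) * V) := by ring
        _ ≤ _ := by gcongr; rw [add_right_comm]; exact le_add_self
  · have hvol := le_volume_normShell hd hl hR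
    rw [← hω, ← hh₀, ← hQ, ← hS] at hvol
    have hd0 : (h₀ * Q) ^ (d : ℝ) ≠ 0 := by simp [hh0, hQ0]
    have hS0 : volume S ≠ 0 := fun h => by
      rw [h, nonpos_iff_eq_zero] at hvol
      exact (mul_ne_zero hd0 hω0) hvol
    have h1 := enorm_sub_setAverage_le_gagliardoSlice hs hp (measurableSet_normShell d R (l * R))
      hS0 (volume_normShell_ne_top _ _ _) hu hui (x := x) (δ := 2 * l * R) (fun y hy => by
        have := norm_sub_le y x
        have h1 := hy.2
        have h2 := hx.2
        linarith)
    rw [← hS, ENNReal.ofReal_mul (by positivity), ← hQ] at h1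
    refine h1.trans ?_
    have hL0 : ENNReal.ofReal (2 * l) ≠ 0 := by simp; linarith
    have e0 : volume S ^ (-(1 / p)) ≤
        h₀ ^ (-((d : ℝ) / p)) * Q ^ (-((d : ℝ) / p)) * ω ^ (-(1 / p)) := by
      have e3 : (d : ℝ) * -(1 / p) = -((d : ℝ) / p) := by ring
      rw [← e3, ← ENNReal.mul_rpow_of_ne_zero hh0 hQ0, ENNReal.rpow_mul,
        ← ENNReal.mul_rpow_of_ne_zero hd0 hω0]
      rw [ENNReal.rpow_neg, ENNReal.rpow_neg]
      exact ENNReal.inv_le_inv.2 (ENNReal.rpow_le_rpow hvol (by positivity))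
    have e1 : Q ^ (-((d : ℝ) / p)) * Q ^ ((d : ℝ) / p + s) = Q ^ s' * Q ^ (s - s') := by
      rw [← ENNReal.rpow_add _ _ hQ0 hQt, ← ENNReal.rpow_add _ _ hQ0 hQt]
      congr 1; ring
    have e2 : Q ^ s' ≤ h₀ ^ (-s') * ρ ^ s' := by
      have h2 : (h₀ * Q) ^ s' ≤ ρ ^ s' := by
        rw [hh₀, hQ, ← ENNReal.ofReal_mul hl0.le]
        exact ENNReal.rpow_le_rpow (ENNReal.ofReal_le_ofReal hrR) hs'0
      calc Q ^ s' = h₀ ^ (-s') * (h₀ ^ s' * Q ^ s') := by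
            rw [← mul_assoc, ← ENNReal.rpow_add _ _ hh0 hht]; simp
        _ ≤ _ := by rw [← ENNReal.mul_rpow_of_nonneg _ _ hs'0]; gcongr
    calc volume S ^ (-(1 / p)) * ((ENNReal.ofReal (2 * l) * Q) ^ ((d : ℝ) / p + s) * K)
        ≤ (h₀ ^ (-((d : ℝ) / p)) * Q ^ (-((d : ℝ) / p)) * ω ^ (-(1 / p))) *
          ((ENNReal.ofReal (2 * l) * Q) ^ ((d : ℝ) / p + s) * K) := by gcongr
      _ = ω ^ (-(1 / p)) * h₀ ^ (-((d : ℝ) / p)) * ENNReal.ofReal (2 * l) ^ ((d : ℝ) / p + s) *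
          (Q ^ (-((d : ℝ) / p)) * Q ^ ((d : ℝ) / p + s)) * K := by
          rw [ENNReal.mul_rpow_of_ne_zero hL0 hQ0]; ring
      _ = ω ^ (-(1 / p)) * h₀ ^ (-((d : ℝ) / p)) * ENNReal.ofReal (2 * l) ^ ((d : ℝ) / p + s) *
          (Q ^ s' * Q ^ (s - s')) * K := by rw [e1]
      _ ≤ ω ^ (-(1 / p)) * h₀ ^ (-((d : ℝ) / p)) * ENNReal.ofReal (2 * l) ^ ((d : ℝ) / p + s) *
          ((h₀ ^ (-s') * ρ ^ s') * Q ^ (s - s')) * K := by gcongr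
      _ = (ω ^ (-(1 / p)) * h₀ ^ (-((d : ℝ) / p)) *
          ENNReal.ofReal (2 * l) ^ ((d : ℝ) / p + s) * h₀ ^ (-s')) *
          (ρ ^ s' * (Q ^ (s - s') * K)) := by ring
      _ ≤ _ := by
          gcongr
          · exact le_add_self
          · exact le_self_add

end Kernel

/-- The two terms balance at r^(e+k) = V/G, which is an admissible scale when G is neither 0 nor ∞.
-/
theorem ENNReal.le_rpow_mul_rpow_of_forall_scale {v G V C : ℝ≥0∞} {k e : ℝ} (hk : 0 < k)
    (he : 0 ≤ e) (hC : C ≠ ∞) (hV0 : V ≠ 0) (hVt : V ≠ ∞)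
    (h : ∀ r : ℝ, 0 < r → v ≤ C * (ENNReal.ofReal r ^ e * G + ENNReal.ofReal r ^ (-k) * V)) :
    v ≤ 2 * C * (G ^ (k / (e + k)) * V ^ (1 - k / (e + k))) := by
  have hek : 0 < e + k := by positivity
  have hθ : 0 < k / (e + k) := by positivity
  rcases eq_or_ne G ∞ with rfl | hGt
  · rcases eq_or_ne C 0 with rfl | hC0
    · simpa using h 1 one_pos
    · rw [ENNReal.top_rpow_of_pos hθ, ENNReal.top_mul, ENNReal.mul_top]
      · exact le_top
      · simp [hC0]
      · exact (ENNReal.rpow_pos (pos_iff_ne_zero.2 hV0) hVt).ne'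
  rcases eq_or_ne G 0 with rfl | hG0
  -- For G = 0 no scale balances; letting r tend to infinity gives v = 0.
  · have h1 : Filter.Tendsto (fun r : ℝ => C * V * ENNReal.ofReal (r ^ (-k))) Filter.atTop
        (nhds (C * V * ENNReal.ofReal 0)) :=
      ENNReal.Tendsto.const_mul (ENNReal.tendsto_ofReal (tendsto_rpow_neg_atTop hk))
        (Or.inr (ENNReal.mul_ne_top hC hVt))
    have h2 : v ≤ C * V * ENNReal.ofReal 0 := by
      refine ge_of_tendsto h1 ?_
      filter_upwards [Filter.eventually_gt_atTop 0] with r hr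
      refine (h r hr).trans (le_of_eq ?_)
      rw [mul_zero, zero_add, ENNReal.ofReal_rpow_of_pos hr]
      ring
    simp only [ENNReal.ofReal_zero, mul_zero, nonpos_iff_eq_zero] at h2
    rw [h2]
    exact zero_le
  set w := V / G with hw
  have hw0 : w ≠ 0 := ENNReal.div_ne_zero.2 ⟨hV0, hGt⟩
  have hwt : w ≠ ∞ := ENNReal.div_ne_top hVt hG0
  have hVw : V = w * G := (ENNReal.div_mul_cancel hG0 hGt).symm
  have hρt : w ^ (1 / (e + k)) ≠ ∞ := ENNReal.rpow_ne_top_of_ne_zero hw0 hwt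
  have hρ0 : w ^ (1 / (e + k)) ≠ 0 := (ENNReal.rpow_pos (pos_iff_ne_zero.2 hw0) hwt).ne'
  have h1 := h (w ^ (1 / (e + k))).toReal (ENNReal.toReal_pos hρ0 hρt)
  rw [ENNReal.ofReal_toReal hρt, ← ENNReal.rpow_mul, ← ENNReal.rpow_mul] at h1
  have e1 : w ^ (1 / (e + k) * e) * G = G ^ (k / (e + k)) * V ^ (1 - k / (e + k)) := by
    rw [hVw, ENNReal.mul_rpow_of_ne_zero hw0 hG0, mul_left_comm, ← ENNReal.rpow_add _ _ hG0 hGt,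
      add_sub_cancel, ENNReal.rpow_one]
    congr 2
    field_simp
    ring
  have e2 : w ^ (1 / (e + k) * -k) * V = G ^ (k / (e + k)) * V ^ (1 - k / (e + k)) := by
    rw [← e1, hVw, ← mul_assoc]
    congr 1
    nth_rewrite 2 [← ENNReal.rpow_one w]
    rw [← ENNReal.rpow_add _ _ hw0 hwt]
    congr 1
    field_simp
    ring
  rw [e1, e2] at h1
  refine h1.trans (le_of_eq ?_)
  ring

theorem ENNReal.rpow_le_of_le_rpow_one_sub_mul {I M : ℝ≥0∞} {η : ℝ} (h0 : I ≠ 0) (ht : I ≠ ∞)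
    (h : I ≤ I ^ (1 - η) * M) : I ^ η ≤ M := by
  have h1 : I ^ (1 - η) ≠ 0 := (ENNReal.rpow_pos (pos_iff_ne_zero.2 h0) ht).ne'
  have h2 : I ^ (1 - η) ≠ ∞ := ENNReal.rpow_ne_top_of_ne_zero h0 ht
  rw [← ENNReal.mul_le_mul_iff_right h1 h2]
  refine le_trans (le_of_eq ?_) h
  rw [← ENNReal.rpow_add _ _ h0 ht, sub_add_cancel, ENNReal.rpow_one]

/-! ### Fractional Gagliardo–Nirenberg on one shell -/

section Shell

variable {d : ℕ}

theorem integrableOn_of_abs_le {S : Set (EuclideanSpace ℝ (Fin d))} (hS : volume S ≠ ∞)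
    {u : EuclideanSpace ℝ (Fin d) → ℝ} (hu : Measurable u) {M : ℝ} (hM : ∀ x, |u x| ≤ M) :
    IntegrableOn u S :=
  Measure.integrableOn_of_bounded hS hu.aestronglyMeasurable (M := M)
    (Filter.Eventually.of_forall hM)

/-- A fractional Gagliardo–Nirenberg inequality on shells, for the oscillation around the mean. -/
theorem exists_lintegral_oscillation_le (hd : 1 ≤ d) {s s' p q τ a l : ℝ} (hs : 0 < s)
    (hp : 1 < p) (hq : 1 ≤ q) (hτ : 1 ≤ τ) (ha0 : 0 < a) (ha1 : a ≤ 1) (hl : 1 < l)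
    (hs'0 : 0 ≤ s') (hs's : s' ≤ s) (hbal : 1 / τ + a * s' / d = a / p + (1 - a) / q) :
    ∃ C : ℝ≥0∞, C ≠ ∞ ∧ ∀ R : ℝ, 0 < R → ∀ u : EuclideanSpace ℝ (Fin d) → ℝ, Measurable u →
      (∃ M : ℝ, ∀ x, |u x| ≤ M) →
      ∫⁻ x in normShell d R (l * R), ‖u x - ⨍ y in normShell d R (l * R), u y‖ₑ ^ τ ≤
        C * ENNReal.ofReal R ^ ((s - s') * (a * τ)) *
          (∫⁻ x in normShell d R (l * R), gagliardoSlice s p (normShell d R (l * R)) u x)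
            ^ (a * τ / p) *
          (∫⁻ x in normShell d R (l * R), ‖u x - ⨍ y in normShell d R (l * R), u y‖ₑ ^ q)
            ^ ((1 - a) * τ / q) := by
  have hp0 : 0 < p := by linarith
  have hq0 : 0 < q := by linarith
  have hτ0 : 0 < τ := by linarith
  have hd0 : (0 : ℝ) < d := by exact_mod_cast hd
  have h1a : 0 ≤ 1 - a := by linarith
  obtain ⟨C, hC, H⟩ := exists_enorm_sub_average_le hd hs hp hτ hl hs'0 hs's
  -- The exponent θ is the outcome of the optimisation in r with e = s' and k = d/τ. Of the power τ,
  -- the pointwise bound is applied to the part t, and the part η(1-a)τ is kept for the L^q norm.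
  -- The value of η makes the Hölder exponents in `hsum` add up to one, and I then reappears with
  -- exponent 1 - η < 1.
  set θ : ℝ := (d / τ) / (s' + d / τ) with hθ
  set η : ℝ := d / (d + a * s' * τ) with hη
  have hη0 : 0 < η := by positivity
  set t : ℝ := τ - η * ((1 - a) * τ) with ht
  have hη1 : η ≤ 1 := by
    rw [hη, div_le_one (by positivity)]
    have : 0 ≤ a * s' * τ := by positivity
    linarith
  have ht0 : 0 ≤ t := by
    have : η * ((1 - a) * τ) ≤ 1 * (1 * τ) := by gcongr; linarith
    rw [ht]; linarith
  have hθt : θ * t = η * (a * τ) := by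
    rw [ht, hθ, hη]; field_simp; ring
  have hθt' : (1 - θ) * t = τ * (1 - η) := by
    rw [sub_mul, hθt, ht]; ring
  have hsum : η * (a * τ / p) + η * ((1 - a) * τ / q) = 1 := by
    have : η * (a * τ / p) + η * ((1 - a) * τ / q) = η * τ * (a / p + (1 - a) / q) := by ring
    rw [this, ← hbal, hη]; field_simp
  refine ⟨((2 * C) ^ t) ^ η⁻¹, ENNReal.rpow_ne_top_of_nonneg (by positivity)
    (ENNReal.rpow_ne_top_of_nonneg ht0 (ENNReal.mul_ne_top (by simp) hC)), ?_⟩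
  rintro R hR u hu ⟨M, hM⟩
  have hui : IntegrableOn u (normShell d R (l * R)) :=
    integrableOn_of_abs_le (volume_normShell_ne_top _ _ _) hu hM
  have H := H R hR u hu hui
  set S := normShell d R (l * R) with hS
  set c := ⨍ y in S, u y
  set I := ∫⁻ y in S, ‖u y - c‖ₑ ^ τ with hI
  set K := gagliardoSlice s p S u
  set Q := ENNReal.ofReal R with hQ
  have hKm : Measurable K := measurable_gagliardoSlice s p S hu
  have hQ0 : Q ≠ 0 := by simpa [hQ] using hR
  have hQt : Q ≠ ∞ := ENNReal.ofReal_ne_top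
  rcases eq_or_ne I 0 with hI0 | hI0
  · rw [hI0]; exact zero_le
  -- The absorption of I^(1-η) needs I finite; this is the use of the bound on u.
  have hIt : I ≠ ∞ := by
    have h1 : I ≤ ∫⁻ y in S, ENNReal.ofReal (M + |c|) ^ τ := by
      refine lintegral_mono fun y => ENNReal.rpow_le_rpow ?_ hτ0.le
      rw [Real.enorm_eq_ofReal_abs]
      exact ENNReal.ofReal_le_ofReal ((abs_sub _ _).trans (by linarith [hM y]))
    rw [setLIntegral_const] at h1
    exact (h1.trans_lt (ENNReal.mul_lt_top
      (ENNReal.rpow_lt_top_of_nonneg hτ0.le ENNReal.ofReal_ne_top)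
      (volume_normShell_ne_top _ _ _).lt_top)).ne
  have hpt : ∀ x ∈ S, ‖u x - c‖ₑ ≤ 2 * C * ((Q ^ (s - s') * K x ^ (1 / p)) ^ θ *
      (I ^ (1 / τ)) ^ (1 - θ)) := fun x hx =>
    ENNReal.le_rpow_mul_rpow_of_forall_scale (by positivity) hs'0 hC
      (ENNReal.rpow_pos (pos_iff_ne_zero.2 hI0) hIt).ne'
      (ENNReal.rpow_ne_top_of_ne_zero hI0 hIt) (H x hx)
  have hpt' : ∀ x ∈ S, ‖u x - c‖ₑ ^ τ ≤ ((2 * C) ^ t * Q ^ ((s - s') * (a * τ) * η) *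
      I ^ (1 - η)) * (K x ^ (η * (a * τ / p)) * (‖u x - c‖ₑ ^ q) ^ (η * ((1 - a) * τ / q))) := by
    intro x hx
    have hθ0 : 0 ≤ θ := by positivity
    calc ‖u x - c‖ₑ ^ τ = ‖u x - c‖ₑ ^ t * ‖u x - c‖ₑ ^ (η * ((1 - a) * τ)) := by
          rw [← ENNReal.rpow_add_of_nonneg _ _ ht0 (by positivity), ht, sub_add_cancel]
      _ ≤ (2 * C * ((Q ^ (s - s') * K x ^ (1 / p)) ^ θ * (I ^ (1 / τ)) ^ (1 - θ))) ^ t *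
          ‖u x - c‖ₑ ^ (η * ((1 - a) * τ)) := by
          gcongr
          exact hpt x hx
      _ = _ := by
          simp only [ENNReal.mul_rpow_of_nonneg _ _ ht0, ENNReal.mul_rpow_of_nonneg _ _ hθ0,
            ← ENNReal.rpow_mul]
          have e1 : (s - s') * θ * t = (s - s') * (a * τ) * η := by rw [mul_assoc, hθt]; ring
          have e2 : 1 / p * θ * t = η * (a * τ / p) := by rw [mul_assoc, hθt]; ring
          have e3 : 1 / τ * (1 - θ) * t = 1 - η := by rw [mul_assoc, hθt']; field_simp
          have e4 : q * (η * ((1 - a) * τ / q)) = η * ((1 - a) * τ) := by field_simp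
          rw [e1, e2, e3, e4]
          ring
  have hint : I ≤ I ^ (1 - η) * ((2 * C) ^ t * Q ^ ((s - s') * (a * τ) * η) *
      ((∫⁻ x in S, K x) ^ (η * (a * τ / p)) *
        (∫⁻ x in S, ‖u x - c‖ₑ ^ q) ^ (η * ((1 - a) * τ / q)))) := by
    calc I ≤ ∫⁻ x in S, ((2 * C) ^ t * Q ^ ((s - s') * (a * τ) * η) * I ^ (1 - η)) *
          (K x ^ (η * (a * τ / p)) * (‖u x - c‖ₑ ^ q) ^ (η * ((1 - a) * τ / q))) :=
          setLIntegral_mono' (measurableSet_normShell _ _ _) hpt'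
      _ = ((2 * C) ^ t * Q ^ ((s - s') * (a * τ) * η) * I ^ (1 - η)) * ∫⁻ x in S,
          (K x ^ (η * (a * τ / p)) * (‖u x - c‖ₑ ^ q) ^ (η * ((1 - a) * τ / q))) := by
          rw [lintegral_const_mul _ (by fun_prop)]
      _ ≤ ((2 * C) ^ t * Q ^ ((s - s') * (a * τ) * η) * I ^ (1 - η)) *
          ((∫⁻ x in S, K x) ^ (η * (a * τ / p)) *
        (∫⁻ x in S, ‖u x - c‖ₑ ^ q) ^ (η * ((1 - a) * τ / q))) := by
          gcongr
          exact ENNReal.lintegral_mul_norm_pow_le (by fun_prop) (by fun_prop) (by positivity)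
            (by positivity) hsum
      _ = _ := by ring
  have hfin := ENNReal.rpow_le_rpow (ENNReal.rpow_le_of_le_rpow_one_sub_mul hI0 hIt hint)
    (inv_nonneg.2 hη0.le)
  have hηi : 0 ≤ η⁻¹ := inv_nonneg.2 hη0.le
  rw [← ENNReal.rpow_mul, mul_inv_cancel₀ hη0.ne', ENNReal.rpow_one] at hfin
  refine hfin.trans (le_of_eq ?_)
  rw [ENNReal.mul_rpow_of_nonneg _ _ hηi, ENNReal.mul_rpow_of_nonneg _ _ hηi,
    ENNReal.mul_rpow_of_nonneg _ _ hηi]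
  simp only [← ENNReal.rpow_mul]
  have e : ∀ z : ℝ, η * z * η⁻¹ = z := fun z => by field_simp
  rw [e, e, mul_assoc _ η, mul_inv_cancel₀ hη0.ne', mul_one]
  ring

/-- By Jensen, the mean, seen as a constant function on S, has L^q norm at most that of u. -/
theorem lintegral_sub_setAverage_rpow_le {S : Set (EuclideanSpace ℝ (Fin d))}
    (h0 : volume S ≠ 0) (ht : volume S ≠ ∞) {q : ℝ} (hq : 1 ≤ q)
    {u : EuclideanSpace ℝ (Fin d) → ℝ} (hu : Measurable u) (hui : IntegrableOn u S) :
    ∫⁻ x in S, ‖u x - ⨍ y in S, u y‖ₑ ^ q ≤ 2 ^ q * ∫⁻ x in S, ‖u x‖ₑ ^ q := by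
  have hq0 : 0 < q := by linarith
  have h1 := (enorm_setAverage_sub_mul_le h0 ht hui 0)
  simp only [sub_zero] at h1
  have h2 := h1.trans (lintegral_le_measure_rpow_mul (by fun_prop) hq)
  rw [Measure.restrict_apply_univ] at h2
  have h3 := ENNReal.rpow_le_rpow (ENNReal.le_rpow_neg_mul_of_mul_le h0 ht h2) hq0.le
  rw [ENNReal.mul_rpow_of_nonneg _ _ hq0.le, ← ENNReal.rpow_mul, ← ENNReal.rpow_mul,
    one_div_mul_cancel hq0.ne', ENNReal.rpow_one,
    show -(1 / q) * q = -1 by field_simp, ENNReal.rpow_neg_one] at h3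
  calc ∫⁻ x in S, ‖u x - ⨍ y in S, u y‖ₑ ^ q
      ≤ ∫⁻ x in S, 2 ^ (q - 1) * (‖u x‖ₑ ^ q + ‖⨍ y in S, u y‖ₑ ^ q) :=
        lintegral_mono fun x => (ENNReal.rpow_le_rpow enorm_sub_le hq0.le).trans
          (ENNReal.rpow_add_le_mul_rpow_add_rpow _ _ hq)
    _ = 2 ^ (q - 1) * ((∫⁻ x in S, ‖u x‖ₑ ^ q) + ‖⨍ y in S, u y‖ₑ ^ q * volume S) := by
        rw [lintegral_const_mul _ (by fun_prop), lintegral_add_left (by fun_prop),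
          setLIntegral_const]
    _ ≤ 2 ^ (q - 1) * ((∫⁻ x in S, ‖u x‖ₑ ^ q) +
          ((volume S)⁻¹ * ∫⁻ x in S, ‖u x‖ₑ ^ q) * volume S) := by gcongr
    _ = 2 ^ (q - 1) * (2 * ∫⁻ x in S, ‖u x‖ₑ ^ q) := by
        rw [mul_right_comm, ENNReal.inv_mul_cancel h0 ht, one_mul, two_mul]
    _ = _ := by
        rw [← mul_assoc]
        nth_rewrite 2 [← ENNReal.rpow_one 2]
        rw [← ENNReal.rpow_add _ _ (by simp) (by simp), sub_add_cancel]

end Shell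

theorem Real.rpow_le_rpow_abs_mul_rpow {L r y : ℝ} (hL : 0 < L) (hr : 0 < r) (hy : 0 < y)
    (h1 : r ≤ L * y) (h2 : y ≤ L * r) (e : ℝ) : y ^ e ≤ L ^ |e| * r ^ e := by
  rcases le_total 0 e with he | he
  · rw [abs_of_nonneg he, ← Real.mul_rpow hL.le hr.le]
    exact Real.rpow_le_rpow hy.le h2 he
  · have h3 : L ^ |e| = L⁻¹ ^ e := by
      rw [abs_of_nonpos he, Real.inv_rpow hL.le, Real.rpow_neg hL.le]
    rw [h3, ← Real.mul_rpow (inv_nonneg.2 hL.le) hr.le]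
    exact Real.rpow_le_rpow_of_nonpos (by positivity) (by
      rw [inv_mul_le_iff₀ hL]; exact h1) he

/-! ### Weighted, scale invariant estimates on shells -/

section Dyadic

variable {d : ℕ}

/-- The inner integral of the localized weighted Gagliardo energy. -/
noncomputable def weightedSlice (s p α Λ : ℝ) (u : EuclideanSpace ℝ (Fin d) → ℝ)
    (y : EuclideanSpace ℝ (Fin d)) : ℝ≥0∞ :=
  ∫⁻ x, ENNReal.ofReal (|u x - u y| ^ p * ‖x‖ ^ (α * p) / ‖x - y‖ ^ ((d : ℝ) + s * p)
      * chiCut Λ ‖x‖ ‖y‖)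

theorem chiCut_nonneg (Λ r₁ r₂ : ℝ) : 0 ≤ chiCut Λ r₁ r₂ := by
  unfold chiCut; split_ifs <;> norm_num

/-- The ratio Λ of the radii is exactly what keeps the cut-off equal to 1 on pairs of points of the
shell; there ‖x‖^(αp) is comparable to R^(αp). -/
theorem gagliardoSlice_le_weightedSlice {s p α Λ R : ℝ} (hΛ : 1 < Λ) (hR : 0 < R)
    (u : EuclideanSpace ℝ (Fin d) → ℝ) {y : EuclideanSpace ℝ (Fin d)}
    (hy : y ∈ normShell d R (Λ * R)) :
    gagliardoSlice s p (normShell d R (Λ * R)) u y ≤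
      ENNReal.ofReal (Λ ^ |α * p|) * ENNReal.ofReal R ^ (-(α * p)) *
        weightedSlice s p α Λ u y := by
  have hΛ0 : 0 < Λ := by linarith
  rw [ENNReal.ofReal_rpow_of_pos hR, ← ENNReal.ofReal_mul (by positivity), weightedSlice,
    ← lintegral_const_mul' _ _ ENNReal.ofReal_ne_top]
  refine le_trans (setLIntegral_mono' (measurableSet_normShell _ _ _) fun x hx => ?_)
    (setLIntegral_le_lintegral (normShell d R (Λ * R)) _)
  obtain ⟨hx1, hx2⟩ := hx
  obtain ⟨hy1, hy2⟩ := hy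
  have hx0 : 0 < ‖x‖ := by linarith
  have hchi : chiCut Λ ‖x‖ ‖y‖ = 1 := by
    unfold chiCut
    rw [if_pos]
    constructor
    · rw [inv_mul_le_iff₀ hΛ0]; nlinarith
    · nlinarith
  rw [hchi, ← ENNReal.ofReal_mul (by positivity)]
  apply ENNReal.ofReal_le_ofReal
  have h1 := Real.rpow_le_rpow_abs_mul_rpow hΛ0 hx0 hR hx2.le (by nlinarith) (α * p)
  have h2 : 1 ≤ Λ ^ |α * p| * R ^ (-(α * p)) * ‖x‖ ^ (α * p) := by
    rw [Real.rpow_neg hR.le]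
    have : 0 < R ^ (α * p) := by positivity
    calc (1 : ℝ) = (R ^ (α * p))⁻¹ * R ^ (α * p) := by field_simp
      _ ≤ (R ^ (α * p))⁻¹ * (Λ ^ |α * p| * ‖x‖ ^ (α * p)) := by gcongr
      _ = _ := by ring
  have h3 : 0 ≤ |u x - u y| ^ p / ‖x - y‖ ^ ((d : ℝ) + s * p) := by positivity
  calc |u x - u y| ^ p / ‖x - y‖ ^ ((d : ℝ) + s * p)
      = |u x - u y| ^ p / ‖x - y‖ ^ ((d : ℝ) + s * p) * 1 := (mul_one _).symm
    _ ≤ |u x - u y| ^ p / ‖x - y‖ ^ ((d : ℝ) + s * p) *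
        (Λ ^ |α * p| * R ^ (-(α * p)) * ‖x‖ ^ (α * p)) := by gcongr
    _ = _ := by ring

theorem lintegral_normShell_rpow_le_weighted {q β Λ R : ℝ} (hq : 1 ≤ q) (hΛ : 1 < Λ) (hR : 0 < R)
    (u : EuclideanSpace ℝ (Fin d) → ℝ) :
    ∫⁻ x in normShell d R (Λ * R), ‖u x‖ₑ ^ q ≤
      ENNReal.ofReal (Λ ^ |β * q|) * ENNReal.ofReal R ^ (-(β * q)) *
        ∫⁻ x in normShell d R (Λ * R), ‖‖x‖ ^ β * u x‖ₑ ^ q := by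
  have hΛ0 : 0 < Λ := by linarith
  have hq0 : 0 < q := by linarith
  rw [ENNReal.ofReal_rpow_of_pos hR, ← ENNReal.ofReal_mul (by positivity),
    ← lintegral_const_mul' _ _ ENNReal.ofReal_ne_top]
  refine setLIntegral_mono' (measurableSet_normShell _ _ _) fun x ⟨hx1, hx2⟩ => ?_
  have hx0 : 0 < ‖x‖ := by linarith
  have h1 := Real.rpow_le_rpow_abs_mul_rpow hΛ0 hx0 hR hx2.le (by nlinarith) (β * q)
  have h2 : 1 ≤ Λ ^ |β * q| * R ^ (-(β * q)) * ‖x‖ ^ (β * q) := by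
    rw [Real.rpow_neg hR.le]
    have : 0 < R ^ (β * q) := by positivity
    calc (1 : ℝ) = (R ^ (β * q))⁻¹ * R ^ (β * q) := by field_simp
      _ ≤ (R ^ (β * q))⁻¹ * (Λ ^ |β * q| * ‖x‖ ^ (β * q)) := by gcongr
      _ = _ := by ring
  rw [enorm_mul, ENNReal.mul_rpow_of_nonneg _ _ hq0.le, Real.enorm_eq_ofReal (r := ‖x‖ ^ β) (by positivity),
    ENNReal.ofReal_rpow_of_nonneg (by positivity) hq0.le, ← Real.rpow_mul hx0.le, ← mul_assoc,
    ← ENNReal.ofReal_mul (by positivity)]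
  calc ‖u x‖ₑ ^ q = 1 * ‖u x‖ₑ ^ q := (one_mul _).symm
    _ ≤ _ := by
      gcongr
      rw [← ENNReal.ofReal_one]
      exact ENNReal.ofReal_le_ofReal h2

theorem volume_normShell_ne_zero (hd : 1 ≤ d) {l R : ℝ} (hl : 1 < l) (hR : 0 < R) :
    volume (normShell d R (l * R)) ≠ 0 := by
  have h0 : ENNReal.ofReal ((l - 1) / 2) ≠ 0 := by simpa using hl
  have h1 : ENNReal.ofReal R ≠ 0 := by simpa using hR
  refine fun h => ?_
  have := le_volume_normShell hd hl hR
  rw [h, nonpos_iff_eq_zero] at this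
  exact mul_ne_zero (by simp [h0, h1]) volume_unitBall_ne_zero this

/-- The scale invariant oscillation of `u` on the shell of radii `R` and `Λ R`. -/
noncomputable def shellOscillation (d : ℕ) (τ Λ R : ℝ) (u : EuclideanSpace ℝ (Fin d) → ℝ) : ℝ≥0∞ :=
  ENNReal.ofReal R ^ (-(d : ℝ)) *
    ∫⁻ x in normShell d R (Λ * R), ‖u x - ⨍ y in normShell d R (Λ * R), u y‖ₑ ^ τ

theorem exists_shellOscillation_le (hd : 1 ≤ d) {s p q τ a α β γ σ Λ : ℝ} (hs : 0 < s)
    (hp : 1 < p) (hq : 1 ≤ q) (hτ : 1 ≤ τ) (ha0 : 0 < a) (ha1 : a ≤ 1) (hΛ : 1 < Λ)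
    (hσ : γ = a * σ + (1 - a) * β)
    (hbal : 1 / τ + γ / d = a * (1 / p + (α - s) / d) + (1 - a) * (1 / q + β / d))
    (hασ0 : 0 ≤ α - σ) (hασs : α - σ ≤ s) (h0 : 1 / τ + γ / d = 0) :
    ∃ C : ℝ≥0∞, C ≠ ∞ ∧ ∀ R : ℝ, 0 < R → ∀ u : EuclideanSpace ℝ (Fin d) → ℝ, Measurable u →
      (∃ M : ℝ, ∀ x, |u x| ≤ M) →
      shellOscillation d τ Λ R u ≤
        C * ((∫⁻ y in normShell d R (Λ * R), weightedSlice s p α Λ u y) ^ (a * τ / p) *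
          (∫⁻ x in normShell d R (Λ * R), ‖‖x‖ ^ β * u x‖ₑ ^ q) ^ ((1 - a) * τ / q)) := by
  have hp0 : 0 < p := by linarith
  have hq0 : 0 < q := by linarith
  have hτ0 : 0 < τ := by linarith
  have hd0 : (0 : ℝ) < d := by exact_mod_cast hd
  have h1a : 0 ≤ 1 - a := by linarith
  have hγ : -(d : ℝ) = γ * τ := by
    field_simp at h0
    linarith
  -- Substituting γ = aσ + (1-a)β in the balance condition leaves the unweighted one for s' = s - (α
  -- - σ).
  obtain ⟨C, hC, H⟩ := exists_lintegral_oscillation_le (s' := s - (α - σ)) hd hs hp hq hτ ha0 ha1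
    hΛ (by linarith) (by linarith) (by
      rw [hσ] at hbal
      field_simp at hbal ⊢
      linarith)
  have he1 : 0 ≤ a * τ / p := by positivity
  have he2 : 0 ≤ (1 - a) * τ / q := by positivity
  refine ⟨C * ENNReal.ofReal (Λ ^ |α * p|) ^ (a * τ / p) *
    (2 ^ q * ENNReal.ofReal (Λ ^ |β * q|)) ^ ((1 - a) * τ / q), ?_, ?_⟩
  · refine ENNReal.mul_ne_top (ENNReal.mul_ne_top hC
      (ENNReal.rpow_ne_top_of_nonneg he1 ENNReal.ofReal_ne_top))
      (ENNReal.rpow_ne_top_of_nonneg he2 (ENNReal.mul_ne_top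
        (ENNReal.rpow_ne_top_of_nonneg hq0.le (by simp)) ENNReal.ofReal_ne_top))
  rintro R hR u hu ⟨M, hM⟩
  have hui : IntegrableOn u (normShell d R (Λ * R)) :=
    integrableOn_of_abs_le (volume_normShell_ne_top _ _ _) hu hM
  have h1 := H R hR u hu ⟨M, hM⟩
  have h2 : ∫⁻ x in normShell d R (Λ * R), gagliardoSlice s p (normShell d R (Λ * R)) u x ≤
      ENNReal.ofReal (Λ ^ |α * p|) * ENNReal.ofReal R ^ (-(α * p)) *
        ∫⁻ y in normShell d R (Λ * R), weightedSlice s p α Λ u y := by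
    have hQ0 : ENNReal.ofReal R ≠ 0 := by simpa using hR
    rw [← lintegral_const_mul' _ _ (ENNReal.mul_ne_top ENNReal.ofReal_ne_top
      (ENNReal.rpow_ne_top_of_ne_zero hQ0 ENNReal.ofReal_ne_top))]
    exact setLIntegral_mono' (measurableSet_normShell _ _ _) fun y hy =>
      gagliardoSlice_le_weightedSlice hΛ hR u hy
  have h3 := (lintegral_sub_setAverage_rpow_le (volume_normShell_ne_zero hd hΛ hR)
    (volume_normShell_ne_top _ _ _) hq hu hui).trans
    (mul_le_mul_right (lintegral_normShell_rpow_le_weighted (β := β) hq hΛ hR u) _)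
  unfold shellOscillation
  set S := normShell d R (Λ * R)
  set Q := ENNReal.ofReal R with hQ
  have hQ0 : Q ≠ 0 := by simpa [hQ] using hR
  have hQt : Q ≠ ∞ := ENNReal.ofReal_ne_top
  set W := ∫⁻ y in S, weightedSlice s p α Λ u y
  set N := ∫⁻ x in S, ‖‖x‖ ^ β * u x‖ₑ ^ q
  -- Scale invariance: since -d = γτ, the total exponent of R is τ(γ + a(α - σ) - aα - (1-a)β) = 0.
  have hQe : Q ^ (-(d : ℝ)) * Q ^ ((s - (s - (α - σ))) * (a * τ)) * Q ^ (-(α * p) * (a * τ / p)) *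
      Q ^ (-(β * q) * ((1 - a) * τ / q)) = 1 := by
    simp only [← ENNReal.rpow_add _ _ hQ0 hQt]
    rw [← ENNReal.rpow_zero (x := Q)]
    congr 1
    rw [hγ, hσ]
    field_simp
    ring
  calc Q ^ (-(d : ℝ)) * ∫⁻ x in S, ‖u x - ⨍ y in S, u y‖ₑ ^ τ
      ≤ Q ^ (-(d : ℝ)) * (C * Q ^ ((s - (s - (α - σ))) * (a * τ)) *
          (ENNReal.ofReal (Λ ^ |α * p|) * Q ^ (-(α * p)) * W) ^ (a * τ / p) *
          (2 ^ q * (ENNReal.ofReal (Λ ^ |β * q|) * Q ^ (-(β * q)) * N)) ^ ((1 - a) * τ / q)) := by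
        gcongr
        refine h1.trans ?_
        gcongr
    _ = (C * ENNReal.ofReal (Λ ^ |α * p|) ^ (a * τ / p) *
    (2 ^ q * ENNReal.ofReal (Λ ^ |β * q|)) ^ ((1 - a) * τ / q)) * (Q ^ (-(d : ℝ)) *
        Q ^ ((s - (s - (α - σ))) * (a * τ)) * Q ^ (-(α * p) * (a * τ / p)) *
      Q ^ (-(β * q) * ((1 - a) * τ / q))) * (W ^ (a * τ / p) * N ^ ((1 - a) * τ / q)) := by
        simp only [ENNReal.mul_rpow_of_nonneg _ _ he1, ENNReal.mul_rpow_of_nonneg _ _ he2]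
        rw [ENNReal.rpow_mul Q (-(α * p)), ENNReal.rpow_mul Q (-(β * q))]
        ring
    _ = _ := by rw [hQe, mul_one]

/-- The means over two overlapping shells differ by at most their oscillations. -/
theorem exists_enorm_average_sub_average_le (hd : 1 ≤ d) {τ ρ : ℝ} (hτ : 1 ≤ τ) (hρ : 1 < ρ) :
    ∃ C : ℝ≥0∞, C ≠ ∞ ∧ ∀ R : ℝ, 0 < R → ∀ u : EuclideanSpace ℝ (Fin d) → ℝ, Measurable u →
      ‖(⨍ y in normShell d R (ρ ^ 2 * R), u y) -
          ⨍ y in normShell d (ρ * R) (ρ ^ 2 * (ρ * R)), u y‖ₑ ^ τ ≤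
        C * (shellOscillation d τ (ρ ^ 2) R u + shellOscillation d τ (ρ ^ 2) (ρ * R) u) := by
  have hτ0 : 0 < τ := by linarith
  have hρ0 : 0 < ρ := by linarith
  set ω := volume (Metric.ball (0 : EuclideanSpace ℝ (Fin d)) 1) with hω
  have hω0 : ω ≠ 0 := volume_unitBall_ne_zero
  have hωt : ω ≠ ∞ := volume_unitBall_ne_top
  set h₀ := ENNReal.ofReal ((ρ - 1) / 2) with hh₀
  have hh0 : h₀ ≠ 0 := by simpa [hh₀] using hρ
  set m := h₀ ^ (d : ℝ) * ω with hm
  have hm0 : m ≠ 0 := mul_ne_zero (by simp [hh0]) hω0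
  have hmt : m ≠ ∞ := ENNReal.mul_ne_top
    (ENNReal.rpow_ne_top_of_nonneg (by positivity) ENNReal.ofReal_ne_top) hωt
  refine ⟨m⁻¹ * 2 ^ (τ - 1), ENNReal.mul_ne_top (ENNReal.inv_ne_top.2 hm0)
    (ENNReal.rpow_ne_top_of_nonneg (by linarith) (by simp)), ?_⟩
  intro R hR u hu
  unfold shellOscillation
  have hρR : 0 < ρ * R := by positivity
  have hvol := le_volume_normShell hd hρ hρR
  rw [← hω, ← hh₀] at hvol
  -- The two shells meet in ρR ≤ |x| < ρ²R, whose volume is at least a fixed multiple of (ρR)^d;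
  -- integrating the constant |c - c'|^τ over it loses only a constant.
  have hA1 : normShell d (ρ * R) (ρ * (ρ * R)) ⊆ normShell d R (ρ ^ 2 * R) := fun x ⟨h1, h2⟩ =>
    ⟨by nlinarith, by linarith⟩
  have hA2 : normShell d (ρ * R) (ρ * (ρ * R)) ⊆ normShell d (ρ * R) (ρ ^ 2 * (ρ * R)) :=
    fun x ⟨h1, h2⟩ => ⟨h1, h2.trans (by nlinarith [mul_pos hρ0 hρR])⟩
  set A := normShell d (ρ * R) (ρ * (ρ * R))
  set S := normShell d R (ρ ^ 2 * R)
  set S' := normShell d (ρ * R) (ρ ^ 2 * (ρ * R))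
  set c := ⨍ y in S, u y
  set c' := ⨍ y in S', u y
  set Q := ENNReal.ofReal R with hQ
  set Q' := ENNReal.ofReal (ρ * R) with hQ'
  have hQ'0 : Q' ≠ 0 := by simpa [hQ'] using hρR
  have hQ't : Q' ≠ ∞ := ENNReal.ofReal_ne_top
  have hQQ' : Q'⁻¹ ≤ Q⁻¹ := ENNReal.inv_le_inv.2 (ENNReal.ofReal_le_ofReal (by nlinarith))
  have h1 : ‖c - c'‖ₑ ^ τ * volume A ≤
      2 ^ (τ - 1) * ((∫⁻ x in S, ‖u x - c‖ₑ ^ τ) + ∫⁻ x in S', ‖u x - c'‖ₑ ^ τ) := by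
    calc ‖c - c'‖ₑ ^ τ * volume A = ∫⁻ x in A, ‖c - c'‖ₑ ^ τ := by rw [setLIntegral_const]
      _ ≤ ∫⁻ x in A, 2 ^ (τ - 1) * (‖u x - c‖ₑ ^ τ + ‖u x - c'‖ₑ ^ τ) := by
          refine lintegral_mono fun x => le_trans (ENNReal.rpow_le_rpow ?_ hτ0.le)
            (ENNReal.rpow_add_le_mul_rpow_add_rpow _ _ hτ)
          calc ‖c - c'‖ₑ = ‖(u x - c') - (u x - c)‖ₑ := by congr 1; ring
            _ ≤ ‖u x - c'‖ₑ + ‖u x - c‖ₑ := enorm_sub_le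
            _ = _ := add_comm _ _
      _ = 2 ^ (τ - 1) * ((∫⁻ x in A, ‖u x - c‖ₑ ^ τ) + ∫⁻ x in A, ‖u x - c'‖ₑ ^ τ) := by
          rw [lintegral_const_mul _ (by fun_prop), lintegral_add_left (by fun_prop)]
      _ ≤ _ := by gcongr
  have h2 : m * Q' ^ (d : ℝ) ≤ volume A := by
    refine le_trans (le_of_eq ?_) hvol
    rw [ENNReal.mul_rpow_of_nonneg _ _ (by positivity), hm]; ring
  have h3 : ‖c - c'‖ₑ ^ τ = m⁻¹ * Q' ^ (-(d : ℝ)) * (‖c - c'‖ₑ ^ τ * (m * Q' ^ (d : ℝ))) := by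
    have e1 : m⁻¹ * m = 1 := ENNReal.inv_mul_cancel hm0 hmt
    have e2 : Q' ^ (-(d : ℝ)) * Q' ^ (d : ℝ) = 1 := by
      rw [← ENNReal.rpow_add _ _ hQ'0 hQ't]; simp
    calc ‖c - c'‖ₑ ^ τ = ‖c - c'‖ₑ ^ τ * (m⁻¹ * m) * (Q' ^ (-(d : ℝ)) * Q' ^ (d : ℝ)) := by
          rw [e1, e2, mul_one, mul_one]
      _ = _ := by ring
  have h4 : Q' ^ (-(d : ℝ)) ≤ Q ^ (-(d : ℝ)) := by
    rw [ENNReal.rpow_neg, ENNReal.rpow_neg, ← ENNReal.inv_rpow, ← ENNReal.inv_rpow]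
    exact ENNReal.rpow_le_rpow hQQ' (by positivity)
  rw [h3]
  calc m⁻¹ * Q' ^ (-(d : ℝ)) * (‖c - c'‖ₑ ^ τ * (m * Q' ^ (d : ℝ)))
      ≤ m⁻¹ * Q' ^ (-(d : ℝ)) * (2 ^ (τ - 1) * ((∫⁻ x in S, ‖u x - c‖ₑ ^ τ) +
        ∫⁻ x in S', ‖u x - c'‖ₑ ^ τ)) := by
        exact mul_le_mul_right ((mul_le_mul_right h2 _).trans h1) _
    _ = m⁻¹ * 2 ^ (τ - 1) * (Q' ^ (-(d : ℝ)) * (∫⁻ x in S, ‖u x - c‖ₑ ^ τ) +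
        Q' ^ (-(d : ℝ)) * ∫⁻ x in S', ‖u x - c'‖ₑ ^ τ) := by ring
    _ ≤ _ := by gcongr

end Dyadic

/-! ### Summation over all shells and chains of means -/

section Sum

variable {d : ℕ}

theorem pairwise_disjoint_normShell_zpow {ρ R : ℝ} (hρ : 1 < ρ) (hR : 0 < R) :
    Pairwise (Function.onFun Disjoint
      fun k : ℤ => normShell d (ρ ^ k * R) (ρ ^ (k + 1) * R)) := by
  have key : ∀ {i j : ℤ} {x : EuclideanSpace ℝ (Fin d)}, ρ ^ i * R ≤ ‖x‖ → ‖x‖ < ρ ^ (j + 1) * R →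
      i ≤ j := fun h1 h2 => by
    have := lt_of_mul_lt_mul_right (h1.trans_lt h2) hR.le
    rw [zpow_lt_zpow_iff_right₀ hρ] at this
    omega
  intro i j hij
  refine Set.disjoint_left.2 fun x hxi hxj => hij ?_
  exact le_antisymm (key hxi.1 hxj.2) (key hxj.1 hxi.2)

/-- Each shell is the union of two consecutive members of a disjoint family, so every point is
counted at most twice. -/
theorem tsum_lintegral_normShell_zpow_le {ρ R : ℝ} (hρ : 1 < ρ) (hR : 0 < R)
    (f : EuclideanSpace ℝ (Fin d) → ℝ≥0∞) :
    ∑' k : ℤ, ∫⁻ x in normShell d (ρ ^ k * R) (ρ ^ 2 * (ρ ^ k * R)), f x ≤ 2 * ∫⁻ x, f x := by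
  have hρ0 : ρ ≠ 0 := by linarith
  set A : ℤ → Set (EuclideanSpace ℝ (Fin d)) :=
    fun k => normShell d (ρ ^ k * R) (ρ ^ (k + 1) * R) with hA
  have h1 : ∑' k : ℤ, ∫⁻ x in A k, f x ≤ ∫⁻ x, f x := by
    rw [← lintegral_iUnion (fun k => measurableSet_normShell _ _ _)
      (pairwise_disjoint_normShell_zpow hρ hR)]
    exact setLIntegral_le_lintegral _ _
  have h2 : ∑' k : ℤ, ∫⁻ x in A (k + 1), f x ≤ ∫⁻ x, f x :=
    (ENNReal.tsum_comp_le_tsum_of_injective (add_left_injective (1 : ℤ))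
      (fun k => ∫⁻ x in A k, f x)).trans h1
  rw [two_mul]
  refine le_trans ?_ (add_le_add h1 h2)
  rw [← ENNReal.tsum_add]
  refine ENNReal.tsum_le_tsum fun k => ?_
  refine le_trans (lintegral_mono_set ?_) (lintegral_union_le f (A k) (A (k + 1)))
  rintro x ⟨hx1, hx2⟩
  rcases lt_or_ge ‖x‖ (ρ ^ (k + 1) * R) with h | h
  · exact Or.inl ⟨hx1, h⟩
  · refine Or.inr ⟨h, hx2.trans_eq ?_⟩
    rw [show k + 1 + 1 = 2 + k by ring, zpow_add₀ hρ0]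
    norm_cast
    ring

/-- The sum of the oscillations over all shells. -/
theorem exists_tsum_shellOscillation_le (hd : 1 ≤ d) {s p q τ a α β γ σ ρ : ℝ} (hs : 0 < s)
    (hp : 1 < p) (hq : 1 ≤ q) (hτ : 1 ≤ τ) (ha0 : 0 < a) (ha1 : a ≤ 1) (hρ : 1 < ρ)
    (hσ : γ = a * σ + (1 - a) * β)
    (hbal : 1 / τ + γ / d = a * (1 / p + (α - s) / d) + (1 - a) * (1 / q + β / d))
    (hασ0 : 0 ≤ α - σ) (hασs : α - σ ≤ s) (h0 : 1 / τ + γ / d = 0) :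
    ∃ C : ℝ≥0∞, C ≠ ∞ ∧ ∀ R : ℝ, 0 < R → ∀ u : EuclideanSpace ℝ (Fin d) → ℝ, Measurable u →
      (∃ M : ℝ, ∀ x, |u x| ≤ M) →
      ∑' k : ℤ, shellOscillation d τ (ρ ^ 2) (ρ ^ k * R) u ≤
        C * ((∫⁻ y, weightedSlice s p α (ρ ^ 2) u y) ^ (a * τ / p) *
          (∫⁻ x, ‖‖x‖ ^ β * u x‖ₑ ^ q) ^ ((1 - a) * τ / q)) := by
  have hp0 : 0 < p := by linarith
  have hq0 : 0 < q := by linarith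
  have hτ0 : 0 < τ := by linarith
  have hρ0 : 0 < ρ := by linarith
  have hd0 : (0 : ℝ) < d := by exact_mod_cast hd
  have h1a : 0 ≤ 1 - a := by linarith
  have he1 : 0 ≤ a * τ / p := by positivity
  have he2 : 0 ≤ (1 - a) * τ / q := by positivity
  -- The balance condition gives the value 1 + τ a (s - (α - σ))/d, so α - σ ≤ s is what makes the
  -- series summable by Hölder.
  have hsum : 1 ≤ a * τ / p + (1 - a) * τ / q := by
    have h1 : a / p + (1 - a) / q = 1 / τ + a * (s - (α - σ)) / d := by
      rw [hσ] at hbal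
      field_simp at hbal ⊢
      linarith
    have h2 : a * τ / p + (1 - a) * τ / q = τ * (a / p + (1 - a) / q) := by ring
    rw [h2, h1, mul_add, mul_one_div_cancel hτ0.ne']
    have : 0 ≤ s - (α - σ) := by linarith
    have : 0 ≤ τ * (a * (s - (α - σ)) / d) := by positivity
    linarith
  obtain ⟨C, hC, H⟩ := exists_shellOscillation_le hd hs hp hq hτ ha0 ha1
    (show 1 < ρ ^ 2 by nlinarith) hσ hbal hασ0 hασs h0
  refine ⟨C * (2 ^ (a * τ / p) * 2 ^ ((1 - a) * τ / q)), ENNReal.mul_ne_top hC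
    (ENNReal.mul_ne_top (ENNReal.rpow_ne_top_of_nonneg he1 (by simp))
      (ENNReal.rpow_ne_top_of_nonneg he2 (by simp))), ?_⟩
  intro R hR u hu hM
  calc ∑' k : ℤ, shellOscillation d τ (ρ ^ 2) (ρ ^ k * R) u
      ≤ ∑' k : ℤ, C * ((∫⁻ y in normShell d (ρ ^ k * R) (ρ ^ 2 * (ρ ^ k * R)),
          weightedSlice s p α (ρ ^ 2) u y) ^ (a * τ / p) *
          (∫⁻ x in normShell d (ρ ^ k * R) (ρ ^ 2 * (ρ ^ k * R)), ‖‖x‖ ^ β * u x‖ₑ ^ q)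
            ^ ((1 - a) * τ / q)) :=
        ENNReal.tsum_le_tsum fun k => H _ (by positivity) u hu hM
    _ ≤ C * ((2 * ∫⁻ y, weightedSlice s p α (ρ ^ 2) u y) ^ (a * τ / p) *
          (2 * ∫⁻ x, ‖‖x‖ ^ β * u x‖ₑ ^ q) ^ ((1 - a) * τ / q)) := by
        rw [ENNReal.tsum_mul_left]
        gcongr
        refine (ENNReal.tsum_rpow_mul_rpow_le _ _ he1 he2 hsum).trans ?_
        gcongr
        · exact tsum_lintegral_normShell_zpow_le hρ hR _
        · exact tsum_lintegral_normShell_zpow_le hρ hR _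
    _ = _ := by
        rw [ENNReal.mul_rpow_of_nonneg _ _ he1, ENNReal.mul_rpow_of_nonneg _ _ he2]
        ring

/-- The contribution of one shell splits into the oscillation and the mean. -/
theorem lintegral_normShell_rpow_le_oscillation_add {τ Λ R : ℝ} (hτ : 1 ≤ τ) (hΛ : 0 < Λ)
    (hR : 0 < R) {u : EuclideanSpace ℝ (Fin d) → ℝ} (hu : Measurable u) :
    ENNReal.ofReal R ^ (-(d : ℝ)) * ∫⁻ x in normShell d R (Λ * R), ‖u x‖ₑ ^ τ ≤
      2 ^ (τ - 1) * (shellOscillation d τ Λ R u + ENNReal.ofReal Λ ^ (d : ℝ) *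
        volume (Metric.ball (0 : EuclideanSpace ℝ (Fin d)) 1) *
        ‖⨍ y in normShell d R (Λ * R), u y‖ₑ ^ τ) := by
  have hτ0 : 0 < τ := by linarith
  unfold shellOscillation
  have hvol : volume (normShell d R (Λ * R)) ≤ ENNReal.ofReal Λ ^ (d : ℝ) *
      ENNReal.ofReal R ^ (d : ℝ) * volume (Metric.ball (0 : EuclideanSpace ℝ (Fin d)) 1) := by
    refine (measure_mono (normShell_subset_ball d R (Λ * R))).trans (le_of_eq ?_)
    rw [volume_ball_eq_unit d 0 (by positivity), ENNReal.ofReal_mul hΛ.le,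
      ENNReal.mul_rpow_of_nonneg _ _ (by positivity)]
  set S := normShell d R (Λ * R)
  set c := ⨍ y in S, u y
  set Q := ENNReal.ofReal R with hQ
  have hQ0 : Q ≠ 0 := by simpa [hQ] using hR
  have hQt : Q ≠ ∞ := ENNReal.ofReal_ne_top
  set ω := volume (Metric.ball (0 : EuclideanSpace ℝ (Fin d)) 1)
  have e2 : Q ^ (-(d : ℝ)) * Q ^ (d : ℝ) = 1 := by
    rw [← ENNReal.rpow_add _ _ hQ0 hQt]; simp
  calc Q ^ (-(d : ℝ)) * ∫⁻ x in S, ‖u x‖ₑ ^ τ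
      ≤ Q ^ (-(d : ℝ)) * ∫⁻ x in S, 2 ^ (τ - 1) * (‖u x - c‖ₑ ^ τ + ‖c‖ₑ ^ τ) := by
        gcongr with x
        refine le_trans (ENNReal.rpow_le_rpow ?_ hτ0.le)
          (ENNReal.rpow_add_le_mul_rpow_add_rpow _ _ hτ)
        calc ‖u x‖ₑ = ‖(u x - c) + c‖ₑ := by rw [sub_add_cancel]
          _ ≤ _ := enorm_add_le _ _
    _ = Q ^ (-(d : ℝ)) * (2 ^ (τ - 1) * ((∫⁻ x in S, ‖u x - c‖ₑ ^ τ) + ‖c‖ₑ ^ τ * volume S)) := by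
        rw [lintegral_const_mul _ (by fun_prop), lintegral_add_left (by fun_prop),
          setLIntegral_const]
    _ ≤ Q ^ (-(d : ℝ)) * (2 ^ (τ - 1) * ((∫⁻ x in S, ‖u x - c‖ₑ ^ τ) + ‖c‖ₑ ^ τ *
        (ENNReal.ofReal Λ ^ (d : ℝ) * Q ^ (d : ℝ) * ω))) := by gcongr
    _ = 2 ^ (τ - 1) * (Q ^ (-(d : ℝ)) * (∫⁻ x in S, ‖u x - c‖ₑ ^ τ) +
        ENNReal.ofReal Λ ^ (d : ℝ) * ω * ‖c‖ₑ ^ τ * (Q ^ (-(d : ℝ)) * Q ^ (d : ℝ))) := by ring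
    _ = _ := by rw [e2, mul_one]

/-- The weighted estimate along a monotone chain of consecutive shells, starting from a shell where
the mean vanishes. -/
theorem exists_lintegral_le_of_chain (hd : 1 ≤ d) {s p q τ a α β γ σ ρ μ : ℝ} (hs : 0 < s)
    (hp : 1 < p) (hq : 1 ≤ q) (hτ : 1 ≤ τ) (ha0 : 0 < a) (ha1 : a ≤ 1) (hρ : 1 < ρ)
    (hμ : 1 < μ) (hτμ : τ ≤ μ) (hσ : γ = a * σ + (1 - a) * β)
    (hbal : 1 / τ + γ / d = a * (1 / p + (α - s) / d) + (1 - a) * (1 / q + β / d))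
    (hασ0 : 0 ≤ α - σ) (hασs : α - σ ≤ s) (h0 : 1 / τ + γ / d = 0) :
    ∃ C : ℝ≥0∞, C ≠ ∞ ∧ ∀ R : ℝ, 0 < R → ∀ u : EuclideanSpace ℝ (Fin d) → ℝ, Measurable u →
      (∃ M : ℝ, ∀ x, |u x| ≤ M) → ∀ κ : ℕ → ℤ, Function.Injective κ →
      (∀ j, κ (j + 1) = κ j + 1 ∨ κ j = κ (j + 1) + 1) →
      ⨍ y in normShell d (ρ ^ κ 0 * R) (ρ ^ 2 * (ρ ^ κ 0 * R)), u y = 0 →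
      ∀ T : ℕ → Set (EuclideanSpace ℝ (Fin d)), (∀ j, MeasurableSet (T j)) →
      (∀ j, T j ⊆ normShell d (ρ ^ κ (j + 1) * R) (ρ ^ 2 * (ρ ^ κ (j + 1) * R))) →
      ∀ (F : EuclideanSpace ℝ (Fin d) → ℝ≥0∞) (D : ℝ≥0∞),
      (∀ᵐ x, x ∉ ⋃ j, T j → F x = 0) →
      (∀ j, ∀ x ∈ T j, F x ≤ D * ((j : ℝ≥0∞) + 1) ^ (-μ) *
        ENNReal.ofReal (ρ ^ κ (j + 1) * R) ^ (-(d : ℝ)) * ‖u x‖ₑ ^ τ) →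
      ∫⁻ x, F x ≤ D * C * ((∫⁻ y, weightedSlice s p α (ρ ^ 2) u y) ^ (a * τ / p) *
          (∫⁻ x, ‖‖x‖ ^ β * u x‖ₑ ^ q) ^ ((1 - a) * τ / q)) := by
  have hτ0 : 0 < τ := by linarith
  have hρ0 : 0 < ρ := by linarith
  obtain ⟨C₁, hC₁, H₁⟩ := exists_tsum_shellOscillation_le hd hs hp hq hτ ha0 ha1 hρ hσ hbal
    hασ0 hασs h0
  obtain ⟨C₂, hC₂, H₂⟩ := exists_enorm_average_sub_average_le hd hτ hρ
  obtain ⟨C₃, H₃⟩ := ENNReal.tsum_hardy_le hτ hμ hτμ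
  set B := ENNReal.ofReal (ρ ^ 2) ^ (d : ℝ) *
        volume (Metric.ball (0 : EuclideanSpace ℝ (Fin d)) 1) with hB
  have hBt : B ≠ ∞ := ENNReal.mul_ne_top
    (ENNReal.rpow_ne_top_of_nonneg (by positivity) ENNReal.ofReal_ne_top) volume_unitBall_ne_top
  refine ⟨2 ^ (τ - 1) * (1 + B * (C₃ * (C₂ * 2))) * C₁, ?_, ?_⟩
  · have : (2 : ℝ≥0∞) ^ (τ - 1) ≠ ∞ := ENNReal.rpow_ne_top_of_nonneg (by linarith) (by simp)
    finiteness
  intro R hR u hu hM κ hκ hstep hc0 T hTm hT F D hF0 hF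
  have H₁ := H₁ R hR u hu hM
  set O : ℤ → ℝ≥0∞ := fun k => shellOscillation d τ (ρ ^ 2) (ρ ^ k * R) u with hO
  set c : ℤ → ℝ := fun k => ⨍ y in normShell d (ρ ^ k * R) (ρ ^ 2 * (ρ ^ k * R)), u y with hc
  have hdiff : ∀ k : ℤ, ‖c k - c (k + 1)‖ₑ ^ τ ≤ C₂ * (O k + O (k + 1)) := by
    intro k
    have := H₂ (ρ ^ k * R) (by positivity) u hu
    have e : ρ * (ρ ^ k * R) = ρ ^ (k + 1) * R := by
      rw [zpow_add_one₀ hρ0.ne']; ring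
    rwa [e] at this
  -- The estimate for adjacent shells is symmetric, so a chain may run inwards or outwards.
  have hdiff' : ∀ j, ‖c (κ (j + 1)) - c (κ j)‖ₑ ^ τ ≤ C₂ * (O (κ j) + O (κ (j + 1))) := by
    intro j
    rcases hstep j with h | h
    · rw [h, ← enorm_neg, neg_sub]; exact hdiff _
    · rw [h, add_comm (O _)]; exact hdiff _
  have hardy := H₃ (fun j => ‖c (κ j)‖ₑ) (fun j => ‖c (κ (j + 1)) - c (κ j)‖ₑ)
    (by simp only [hc, hc0, enorm_zero]) (fun j => by
      calc ‖c (κ (j + 1))‖ₑ = ‖c (κ j) + (c (κ (j + 1)) - c (κ j))‖ₑ := by congr 1; ring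
        _ ≤ _ := enorm_add_le _ _)
  have hO1 : ∑' j : ℕ, O (κ (j + 1)) ≤ ∑' k, O k :=
    ENNReal.tsum_comp_le_tsum_of_injective (f := fun j : ℕ => κ (j + 1))
      (hκ.comp (add_left_injective 1)) O
  have hO0 : ∑' j : ℕ, O (κ j) ≤ ∑' k, O k := ENNReal.tsum_comp_le_tsum_of_injective hκ O
  have hE : ∑' j : ℕ, ‖c (κ (j + 1)) - c (κ j)‖ₑ ^ τ ≤ C₂ * (2 * ∑' k, O k) := by
    calc ∑' j : ℕ, ‖c (κ (j + 1)) - c (κ j)‖ₑ ^ τ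
        ≤ ∑' j : ℕ, C₂ * (O (κ j) + O (κ (j + 1))) := ENNReal.tsum_le_tsum hdiff'
      _ = C₂ * (∑' j : ℕ, O (κ j) + ∑' j : ℕ, O (κ (j + 1))) := by
          rw [ENNReal.tsum_mul_left, ENNReal.tsum_add]
      _ ≤ _ := by rw [two_mul]; gcongr
  -- The oscillations are summable by themselves, so their weight is simply dropped; only the means
  -- need its decay.
  have hw1 : ∀ j : ℕ, ((j : ℝ≥0∞) + 1) ^ (-μ) ≤ 1 := fun j => by
    refine (ENNReal.rpow_le_rpow_of_exponent_le le_add_self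
      (show -μ ≤ 0 by linarith)).trans ?_
    rw [ENNReal.rpow_zero]
  have hterm : ∀ j : ℕ, ∫⁻ x in T j, F x ≤
      D * 2 ^ (τ - 1) * (O (κ (j + 1)) + B * (((j : ℝ≥0∞) + 1) ^ (-μ) * ‖c (κ (j + 1))‖ₑ ^ τ)) := by
    intro j
    set r := ρ ^ κ (j + 1) * R with hr
    have hr0 : 0 < r := by positivity
    calc ∫⁻ x in T j, F x
        ≤ ∫⁻ x in T j, D * ((j : ℝ≥0∞) + 1) ^ (-μ) *
            ENNReal.ofReal r ^ (-(d : ℝ)) * ‖u x‖ₑ ^ τ := setLIntegral_mono' (hTm j) (hF j)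
      _ ≤ ∫⁻ x in normShell d r (ρ ^ 2 * r), D * ((j : ℝ≥0∞) + 1) ^ (-μ) *
            ENNReal.ofReal r ^ (-(d : ℝ)) * ‖u x‖ₑ ^ τ := lintegral_mono_set (hT j)
      _ = D * ((j : ℝ≥0∞) + 1) ^ (-μ) * (ENNReal.ofReal r ^ (-(d : ℝ)) *
            ∫⁻ x in normShell d r (ρ ^ 2 * r), ‖u x‖ₑ ^ τ) := by
          rw [lintegral_const_mul _ (by fun_prop)]; ring
      _ ≤ D * ((j : ℝ≥0∞) + 1) ^ (-μ) *
            (2 ^ (τ - 1) * (O (κ (j + 1)) + B * ‖c (κ (j + 1))‖ₑ ^ τ)) := by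
          exact mul_le_mul_right (lintegral_normShell_rpow_le_oscillation_add hτ
            (by positivity) hr0 hu) _
      _ = D * 2 ^ (τ - 1) * (((j : ℝ≥0∞) + 1) ^ (-μ) * O (κ (j + 1)) +
            B * (((j : ℝ≥0∞) + 1) ^ (-μ) * ‖c (κ (j + 1))‖ₑ ^ τ)) := by ring
      _ ≤ D * 2 ^ (τ - 1) * (1 * O (κ (j + 1)) +
            B * (((j : ℝ≥0∞) + 1) ^ (-μ) * ‖c (κ (j + 1))‖ₑ ^ τ)) := by
          gcongr
          exact hw1 j
      _ = _ := by rw [one_mul]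
  calc ∫⁻ x, F x = ∫⁻ x, (⋃ j, T j).indicator F x := by
        refine lintegral_congr_ae ?_
        filter_upwards [hF0] with x hx
        by_cases h : x ∈ ⋃ j, T j
        · rw [Set.indicator_of_mem h]
        · rw [Set.indicator_of_notMem h, hx h]
    _ = ∫⁻ x in ⋃ j, T j, F x := lintegral_indicator (MeasurableSet.iUnion hTm) _
    _ ≤ ∑' j, ∫⁻ x in T j, F x := lintegral_iUnion_le _ _
    _ ≤ ∑' j : ℕ, D * 2 ^ (τ - 1) *
        (O (κ (j + 1)) + B * (((j : ℝ≥0∞) + 1) ^ (-μ) * ‖c (κ (j + 1))‖ₑ ^ τ)) :=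
        ENNReal.tsum_le_tsum hterm
    _ = D * 2 ^ (τ - 1) * (∑' j : ℕ, O (κ (j + 1)) +
        B * ∑' j : ℕ, ((j : ℝ≥0∞) + 1) ^ (-μ) * ‖c (κ (j + 1))‖ₑ ^ τ) := by
        rw [ENNReal.tsum_mul_left, ENNReal.tsum_add, ENNReal.tsum_mul_left]
    _ ≤ D * 2 ^ (τ - 1) * (∑' k, O k + B * (C₃ * (C₂ * (2 * ∑' k, O k)))) := by
        gcongr
        exact hardy.trans (by gcongr)
    _ = D * (2 ^ (τ - 1) * (1 + B * (C₃ * (C₂ * 2)))) * ∑' k, O k := by ring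
    _ ≤ D * (2 ^ (τ - 1) * (1 + B * (C₃ * (C₂ * 2)))) * (C₁ *
          ((∫⁻ y, weightedSlice s p α (ρ ^ 2) u y) ^ (a * τ / p) *
          (∫⁻ x, ‖‖x‖ ^ β * u x‖ₑ ^ q) ^ ((1 - a) * τ / q))) := by gcongr
    _ = _ := by ring

end Sum

/-! ### Reduction to bounded measurable functions -/

section Reduction

variable {d : ℕ}

/-- Truncation of `t` to the interval `[-N, N]`. -/
def truncate (N : ℕ) (t : ℝ) : ℝ := max (-(N : ℝ)) (min t N)

theorem measurable_truncate (N : ℕ) : Measurable (truncate N) := by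
  unfold truncate; fun_prop

theorem abs_truncate (N : ℕ) (t : ℝ) : |truncate N t| = min |t| N := by
  have hN : (0 : ℝ) ≤ N := by positivity
  unfold truncate
  rcases le_total 0 t with ht | ht
  · rw [abs_of_nonneg ht, max_eq_right (by linarith [le_min ht hN]), abs_of_nonneg (le_min ht hN)]
  · rw [abs_of_nonpos ht, min_eq_left (ht.trans hN), abs_of_nonpos (max_le (by linarith) ht),
      min_comm, ← min_neg_neg, neg_neg]

theorem abs_truncate_sub_le (N : ℕ) (t t' : ℝ) : |truncate N t - truncate N t'| ≤ |t - t'| := by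
  unfold truncate
  exact (abs_max_sub_max_le_max _ _ _ _).trans
    (max_le (by simp) ((abs_min_sub_min_le_max _ _ _ _).trans (max_le le_rfl (by simp))))

theorem enorm_truncate_le (N : ℕ) (t : ℝ) : ‖truncate N t‖ₑ ≤ ‖t‖ₑ := by
  rw [Real.enorm_eq_ofReal_abs, Real.enorm_eq_ofReal_abs, abs_truncate]
  exact ENNReal.ofReal_le_ofReal (min_le_left _ _)

theorem weightedSlice_truncate_le {s p α Λ : ℝ} (hp : 0 ≤ p) (N : ℕ)
    (u : EuclideanSpace ℝ (Fin d) → ℝ) (y : EuclideanSpace ℝ (Fin d)) :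
    weightedSlice s p α Λ (fun x => truncate N (u x)) y ≤ weightedSlice s p α Λ u y := by
  refine lintegral_mono fun x => ENNReal.ofReal_le_ofReal ?_
  have h1 := chiCut_nonneg Λ ‖x‖ ‖y‖
  have h2 := Real.rpow_le_rpow (abs_nonneg _) (abs_truncate_sub_le N (u x) (u y)) hp
  dsimp only
  gcongr

theorem lintegral_weightedSlice_congr_ae {s p α Λ : ℝ} {u v : EuclideanSpace ℝ (Fin d) → ℝ}
    (h : u =ᵐ[volume] v) :
    ∫⁻ y, weightedSlice s p α Λ u y = ∫⁻ y, weightedSlice s p α Λ v y := by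
  refine lintegral_congr_ae ?_
  filter_upwards [h] with y hy
  refine lintegral_congr_ae ?_
  filter_upwards [h] with x hx
  rw [hx, hy]

theorem lintegral_mul_rpow_le_of_truncate {w : EuclideanSpace ℝ (Fin d) → ℝ≥0∞} (hw : Measurable w)
    {u : EuclideanSpace ℝ (Fin d) → ℝ} (hu : Measurable u) {τ : ℝ} (hτ : 0 ≤ τ) {B : ℝ≥0∞}
    (h : ∀ N : ℕ, ∫⁻ x, w x * ‖truncate N (u x)‖ₑ ^ τ ≤ B) : ∫⁻ x, w x * ‖u x‖ₑ ^ τ ≤ B := by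
  have hmono : Monotone fun (N : ℕ) x => w x * ‖truncate N (u x)‖ₑ ^ τ := by
    intro N N' hN x
    have hN' : (N : ℝ) ≤ N' := by exact_mod_cast hN
    dsimp only
    gcongr
    rw [Real.enorm_eq_ofReal_abs, Real.enorm_eq_ofReal_abs, abs_truncate, abs_truncate]
    exact ENNReal.ofReal_le_ofReal (min_le_min_left _ hN')
  have hm : ∀ N : ℕ, Measurable fun x => w x * ‖truncate N (u x)‖ₑ ^ τ := fun N =>
    hw.mul (((measurable_truncate N).comp hu).enorm.pow_const τ)
  calc ∫⁻ x, w x * ‖u x‖ₑ ^ τ ≤ ∫⁻ x, ⨆ N : ℕ, w x * ‖truncate N (u x)‖ₑ ^ τ := by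
        refine lintegral_mono fun x => ?_
        obtain ⟨N, hN⟩ := exists_nat_ge |u x|
        refine le_trans (le_of_eq ?_) (le_iSup (fun N : ℕ => w x * ‖truncate N (u x)‖ₑ ^ τ) N)
        dsimp only
        rw [Real.enorm_eq_ofReal_abs, Real.enorm_eq_ofReal_abs, abs_truncate, min_eq_left hN]
    _ = ⨆ N : ℕ, ∫⁻ x, w x * ‖truncate N (u x)‖ₑ ^ τ := lintegral_iSup hm hmono
    _ ≤ B := iSup_le h

/-- The null open sets may be uncountably many; the space is second countable, so a locally null set
is null. -/
theorem ae_eq_zero_of_notMem_essSupport (u : EuclideanSpace ℝ (Fin d) → ℝ) :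
    ∀ᵐ x ∂volume, x ∉ essSupport u → u x = 0 := by
  have : volume {x | x ∉ essSupport u ∧ u x ≠ 0} = 0 := by
    refine measure_null_of_locally_null _ fun x hx => ?_
    have h1 := hx.1
    simp only [essSupport, Set.mem_ofPred_eq, not_forall, not_not] at h1
    obtain ⟨U, hU, hxU, hae⟩ := h1
    refine ⟨{y | ¬ (y ∈ U → u y = 0)}, ?_, hae⟩
    filter_upwards [mem_nhdsWithin_of_mem_nhds (hU.mem_nhds hxU), self_mem_nhdsWithin]
      with y hy hy'
    exact fun h => hy'.2 (h hy)
  rw [ae_iff]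
  convert this using 2
  ext x
  simp

/-- The chain estimate for functions that need not be bounded. -/
theorem exists_lintegral_mul_rpow_le (hd : 1 ≤ d) {s p q τ a α β γ σ ρ μ : ℝ} (hs : 0 < s)
    (hp : 1 < p) (hq : 1 ≤ q) (hτ : 1 ≤ τ) (ha0 : 0 < a) (ha1 : a ≤ 1) (hρ : 1 < ρ)
    (hμ : 1 < μ) (hτμ : τ ≤ μ) (hσ : γ = a * σ + (1 - a) * β)
    (hbal : 1 / τ + γ / d = a * (1 / p + (α - s) / d) + (1 - a) * (1 / q + β / d))
    (hασ0 : 0 ≤ α - σ) (hασs : α - σ ≤ s) (h0 : 1 / τ + γ / d = 0) :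
    ∃ C : ℝ≥0∞, C ≠ ∞ ∧ ∀ R : ℝ, 0 < R → ∀ u : EuclideanSpace ℝ (Fin d) → ℝ,
      AEStronglyMeasurable u volume → ∀ κ : ℕ → ℤ, Function.Injective κ →
      (∀ j, κ (j + 1) = κ j + 1 ∨ κ j = κ (j + 1) + 1) →
      (∀ᵐ x, x ∈ normShell d (ρ ^ κ 0 * R) (ρ ^ 2 * (ρ ^ κ 0 * R)) → u x = 0) →
      ∀ T : ℕ → Set (EuclideanSpace ℝ (Fin d)), (∀ j, MeasurableSet (T j)) →
      (∀ j, T j ⊆ normShell d (ρ ^ κ (j + 1) * R) (ρ ^ 2 * (ρ ^ κ (j + 1) * R))) →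
      (∀ᵐ x, x ∉ ⋃ j, T j → u x = 0) →
      ∀ (w : EuclideanSpace ℝ (Fin d) → ℝ≥0∞) (D : ℝ≥0∞), Measurable w →
      (∀ j, ∀ x ∈ T j, w x ≤ D * ((j : ℝ≥0∞) + 1) ^ (-μ) *
        ENNReal.ofReal (ρ ^ κ (j + 1) * R) ^ (-(d : ℝ))) →
      (∫⁻ x, w x * ‖u x‖ₑ ^ τ) ^ (1 / τ) ≤ (D * C) ^ (1 / τ) *
        fracSeminorm s p α (ρ ^ 2) Set.univ u ^ a *
          eLpNorm (fun x => ‖x‖ ^ β * u x) (ENNReal.ofReal q) volume ^ (1 - a) := by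
  have hp0 : 0 < p := by linarith
  have hq0 : 0 < q := by linarith
  have hτ0 : 0 < τ := by linarith
  have h1a : 0 ≤ 1 - a := by linarith
  obtain ⟨C, hC, H⟩ := exists_lintegral_le_of_chain hd hs hp hq hτ ha0 ha1 hρ hμ hτμ hσ hbal
    hασ0 hασs h0
  refine ⟨C, hC, ?_⟩
  intro R hR u hu κ hκ hstep hu0 T hTm hT huT w D hw hwT
  set v := hu.mk u
  have hvm : Measurable v := hu.stronglyMeasurable_mk.measurable
  have huv : u =ᵐ[volume] v := hu.ae_eq_mk
  have key : ∫⁻ x, w x * ‖u x‖ₑ ^ τ ≤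
      D * C * ((∫⁻ y, weightedSlice s p α (ρ ^ 2) u y) ^ (a * τ / p) *
          (∫⁻ x, ‖‖x‖ ^ β * u x‖ₑ ^ q) ^ ((1 - a) * τ / q)) := by
    have e1 : ∫⁻ x, w x * ‖u x‖ₑ ^ τ = ∫⁻ x, w x * ‖v x‖ₑ ^ τ :=
      lintegral_congr_ae (huv.mono fun x hx => by simp only [hx])
    have e2 : ∫⁻ x, ‖‖x‖ ^ β * u x‖ₑ ^ q = ∫⁻ x, ‖‖x‖ ^ β * v x‖ₑ ^ q :=
      lintegral_congr_ae (huv.mono fun x hx => by simp only [hx])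
    rw [e1, e2, lintegral_weightedSlice_congr_ae huv]
    refine lintegral_mul_rpow_le_of_truncate hw hvm hτ0.le fun N => ?_
    have htr0 : truncate N 0 = 0 := by simp [truncate]
    -- The vanishing of u on the starting shell, rather than of its mean alone, is what survives
    -- truncation.
    have hmean : ⨍ y in normShell d (ρ ^ κ 0 * R) (ρ ^ 2 * (ρ ^ κ 0 * R)),
        truncate N (v y) = 0 := by
      rw [setAverage_eq, setIntegral_eq_zero_of_ae_eq_zero, smul_zero]
      filter_upwards [hu0, huv] with x hx hxv hxS
      rw [← hxv, hx hxS, htr0]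
    have h1 := H R hR (fun x => truncate N (v x)) ((measurable_truncate N).comp hvm)
      ⟨N, fun x => by rw [abs_truncate]; exact min_le_right _ _⟩ κ hκ hstep hmean T hTm hT
      (fun x => w x * ‖truncate N (v x)‖ₑ ^ τ) D (by
        filter_upwards [huT, huv] with x hx hxv hxT
        rw [← hxv, hx hxT, htr0, enorm_zero, ENNReal.zero_rpow_of_pos hτ0, mul_zero])
      (fun j x hx => mul_le_mul_left (hwT j x hx) _)
    refine h1.trans ?_
    gcongr with y x
    · exact weightedSlice_truncate_le hp0.le N v y
    · rw [enorm_mul, enorm_mul]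
      gcongr
      exact enorm_truncate_le N _
  have hfrac : fracSeminorm s p α (ρ ^ 2) Set.univ u =
      (∫⁻ y, weightedSlice s p α (ρ ^ 2) u y) ^ (1 / p) := by
    simp only [fracSeminorm, Measure.restrict_univ, weightedSlice]
  have hnorm : eLpNorm (fun x => ‖x‖ ^ β * u x) (ENNReal.ofReal q) volume =
      (∫⁻ x, ‖‖x‖ ^ β * u x‖ₑ ^ q) ^ (1 / q) := by
    rw [eLpNorm_eq_lintegral_rpow_enorm_toReal (by simpa using hq0) ENNReal.ofReal_ne_top,
      ENNReal.toReal_ofReal hq0.le]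
  refine (ENNReal.rpow_le_rpow key (by positivity)).trans (le_of_eq ?_)
  have hi : 0 ≤ 1 / τ := by positivity
  rw [hfrac, hnorm]
  simp only [ENNReal.mul_rpow_of_nonneg _ _ hi, ← ENNReal.rpow_mul]
  rw [show a * τ / p * (1 / τ) = 1 / p * a by field_simp,
    show (1 - a) * τ / q * (1 / τ) = 1 / q * (1 - a) by field_simp]
  ring

end Reduction

/-! ### Logarithmic weights and the two walks -/

theorem ofReal_rpow_div_log_rpow_le {d : ℕ} {e ρ μ r y L : ℝ} {j : ℕ} (he : e = -(d : ℝ))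
    (hρ : 1 < ρ) (hμ : 0 < μ) (hr : 0 < r) (hry : r ≤ y) (hL : 2 * ρ ^ j ≤ L) :
    ENNReal.ofReal (y ^ e / Real.log L ^ μ) ≤
      ENNReal.ofReal (min (Real.log 2) (Real.log ρ) ^ (-μ)) * ((j : ℝ≥0∞) + 1) ^ (-μ) *
        ENNReal.ofReal r ^ (-(d : ℝ)) := by
  set m := min (Real.log 2) (Real.log ρ)
  have hm : 0 < m := lt_min (Real.log_pos (by norm_num)) (Real.log_pos hρ)
  -- From log L ≥ log 2 + j log ρ. The factor 2 inside the logarithm supplies the term that keeps it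
  -- positive at j = 0.
  have hlog : m * (j + 1) ≤ Real.log L := by
    have h1 := Real.log_le_log (by positivity) hL
    rw [Real.log_mul (by norm_num) (by positivity), Real.log_pow] at h1
    have h2 : m ≤ Real.log 2 := min_le_left _ _
    have h3 : (j : ℝ) * m ≤ j * Real.log ρ := by gcongr; exact min_le_right _ _
    linarith
  have hj : (j : ℝ≥0∞) + 1 = ENNReal.ofReal ((j : ℝ) + 1) := by
    rw [ENNReal.ofReal_add (by positivity) zero_le_one]; simp
  rw [hj, ENNReal.ofReal_rpow_of_pos (by positivity), ENNReal.ofReal_rpow_of_pos hr,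
    ← ENNReal.ofReal_mul (by positivity), ← ENNReal.ofReal_mul (by positivity)]
  apply ENNReal.ofReal_le_ofReal
  have h1 : y ^ e ≤ r ^ (-(d : ℝ)) := by
    rw [he]
    exact Real.rpow_le_rpow_of_nonpos hr hry (by simp)
  have h2 : (Real.log L ^ μ)⁻¹ ≤ m ^ (-μ) * ((j : ℝ) + 1) ^ (-μ) := by
    rw [← Real.mul_rpow hm.le (by positivity), Real.rpow_neg (by positivity)]
    gcongr
  have h3 : 0 < Real.log L := lt_of_lt_of_le (by positivity) hlog
  rw [div_eq_mul_inv, mul_comm]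
  exact mul_le_mul h2 h1 (Real.rpow_nonneg (hr.le.trans hry) _) (by positivity)

theorem exists_zpow_neg_of_lt {ρ R t : ℝ} (hρ : 1 < ρ) (hR : 0 < R) (ht : 0 < t) (htR : t < R) :
    ∃ j : ℕ, ρ ^ (-((j : ℤ) + 1)) * R ≤ t ∧ t < ρ ^ (-(j : ℤ)) * R := by
  obtain ⟨n, hn1, hn2⟩ := exists_mem_Ico_zpow (div_pos ht hR) hρ
  rw [le_div_iff₀ hR] at hn1
  rw [div_lt_iff₀ hR] at hn2
  have hn : n < 0 := by
    have h1 : ρ ^ n < ρ ^ (0 : ℤ) := by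
      rw [zpow_zero]
      exact lt_of_mul_lt_mul_right (by linarith) hR.le
    exact (zpow_lt_zpow_iff_right₀ hρ).1 h1
  refine ⟨(-n - 1).toNat, ?_⟩
  have e : (((-n - 1).toNat : ℕ) : ℤ) = -n - 1 := Int.toNat_of_nonneg (by omega)
  rw [e, show -(-n - 1 + 1) = n by ring, show -(-n - 1) = n + 1 by ring]
  exact ⟨hn1, hn2⟩

theorem exists_pow_of_le {ρ R t : ℝ} (hρ : 1 < ρ) (hR : 0 < R) (htR : R ≤ t) :
    ∃ j : ℕ, ρ ^ j * R ≤ t ∧ t < ρ ^ (j + 1) * R := by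
  obtain ⟨n, hn1, hn2⟩ := exists_nat_pow_near ((one_le_div hR).2 htR) hρ
  exact ⟨n, (le_div_iff₀ hR).1 hn1, (div_lt_iff₀ hR).1 hn2⟩

theorem mainTheorem4 (d : ℕ) (hd : 1 ≤ d) (s p q τ a α β γ μ Λ σ : ℝ)
    (hs0 : 0 < s) (hs1 : s < 1) (hp : 1 < p) (hq : 1 ≤ q) (hτ : 1 ≤ τ)
    (ha0 : 0 < a) (ha1 : a ≤ 1) (hμ : 1 < μ) (hΛ : 1 < Λ) (hτμ : τ ≤ μ)
    (hσ : γ = a * σ + (1 - a) * β)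
    (hbal : 1 / τ + γ / d = a * (1 / p + (α - s) / d) + (1 - a) * (1 / q + β / d))
    (hασ0 : 0 ≤ α - σ) (hασs : α - σ ≤ s) :
    ∃ C : ℝ, 0 < C ∧
      ∀ u : EuclideanSpace ℝ (Fin d) → ℝ, LocallyIntegrableOn u {0}ᶜ volume →
      ∀ R₁ R₂ : ℝ, 0 < R₁ → 0 < R₂ →
        (1 / τ + γ / d = 0 → essSupport u ⊆ Metric.ball 0 R₂ →
          (∫⁻ x, ENNReal.ofReal
              (‖x‖ ^ (γ * τ) / Real.log (2 * R₂ / ‖x‖) ^ μ * |u x| ^ τ)) ^ (1 / τ)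
            ≤ ENNReal.ofReal C * fracSeminorm s p α Λ Set.univ u ^ a
              * eLpNorm (fun x => ‖x‖ ^ β * u x) (ENNReal.ofReal q) volume ^ (1 - a)) ∧
        (1 / τ + γ / d = 0 → essSupport u ∩ Metric.ball 0 R₁ = ∅ →
          (∫⁻ x, ENNReal.ofReal
              (‖x‖ ^ (γ * τ) / Real.log (2 * ‖x‖ / R₁) ^ μ * |u x| ^ τ)) ^ (1 / τ)
            ≤ ENNReal.ofReal C * fracSeminorm s p α Λ Set.univ u ^ a
              * eLpNorm (fun x => ‖x‖ ^ β * u x) (ENNReal.ofReal q) volume ^ (1 - a)) := by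
  by_cases h0 : 1 / τ + γ / d = 0
  swap
  · exact ⟨1, one_pos, fun u _ R₁ R₂ _ _ => ⟨fun h => absurd h h0, fun h => absurd h h0⟩⟩
  have hτ0 : 0 < τ := by linarith
  have hd0 : (0 : ℝ) < d := by exact_mod_cast hd
  have hγ : γ * τ = -(d : ℝ) := by
    field_simp at h0
    linarith
  -- Steps of ratio √Λ let each shell of ratio Λ overlap the next one.
  obtain ⟨ρ, hρ, rfl⟩ : ∃ ρ : ℝ, 1 < ρ ∧ Λ = ρ ^ 2 :=
    ⟨Real.sqrt Λ, by rwa [Real.lt_sqrt zero_le_one, one_pow], (Real.sq_sqrt (by linarith)).symm⟩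
  have hρ0 : 0 < ρ := by linarith
  obtain ⟨C, hC, H⟩ := exists_lintegral_mul_rpow_le hd hs0 hp hq hτ ha0 ha1 hρ hμ hτμ hσ hbal
    hασ0 hασs h0
  set D := ENNReal.ofReal (min (Real.log 2) (Real.log ρ) ^ (-μ))
  have hDC : (D * C) ^ (1 / τ) ≠ ∞ := ENNReal.rpow_ne_top_of_nonneg (by positivity)
    (ENNReal.mul_ne_top ENNReal.ofReal_ne_top hC)
  refine ⟨((D * C) ^ (1 / τ)).toReal + 1, by positivity, ?_⟩
  have hDC' : (D * C) ^ (1 / τ) ≤ ENNReal.ofReal (((D * C) ^ (1 / τ)).toReal + 1) := by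
    rw [ENNReal.ofReal_add ENNReal.toReal_nonneg zero_le_one, ENNReal.ofReal_toReal hDC]
    exact le_self_add
  intro u hu R₁ R₂ hR₁ hR₂
  -- With d ≥ 1 the origin is a null set, so local integrability away from it gives measurability on
  -- the whole space.
  have : Nonempty (Fin d) := ⟨⟨0, hd⟩⟩
  have hne : ∀ᵐ x : EuclideanSpace ℝ (Fin d), x ≠ 0 := by
    rw [ae_iff]
    simp
  have hum : AEStronglyMeasurable u volume := by
    have := hu.aestronglyMeasurable
    rwa [Measure.restrict_eq_self_of_ae_mem] at this
    exact hne
  have hsupp := ae_eq_zero_of_notMem_essSupport u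
  have hsplit : ∀ w : ℝ, ∀ x, ENNReal.ofReal (w * |u x| ^ τ) = ENNReal.ofReal w * ‖u x‖ₑ ^ τ := by
    intro w x
    rw [ENNReal.ofReal_mul' (by positivity), Real.enorm_eq_ofReal_abs,
      ENNReal.ofReal_rpow_of_nonneg (abs_nonneg _) hτ0.le]
  simp only [hsplit]
  refine ⟨fun _ hS => ?_, fun _ hS => ?_⟩
  · have hu0 : ∀ᵐ x, R₂ ≤ ‖x‖ → u x = 0 := by
      filter_upwards [hsupp] with x hx hxR
      refine hx fun h => ?_
      have := hS h
      rw [mem_ball_zero_iff] at this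
      linarith
    -- Walk inwards from R₂ ≤ |x| < ρ²R₂, where u vanishes. The sets T j of ratio ρ are the inner
    -- parts of the shells of index -(j+1), and tile the punctured ball of radius R₂.
    refine (H R₂ hR₂ u hum (fun j => -(j : ℤ)) (fun i j h => by simpa using h)
      (fun j => Or.inr (by push_cast; ring)) ?_
      (fun j => normShell d (ρ ^ (-((j : ℤ) + 1)) * R₂) (ρ ^ (-(j : ℤ)) * R₂))
      (fun j => measurableSet_normShell _ _ _) ?_ ?_
      (fun x => ENNReal.ofReal (‖x‖ ^ (γ * τ) / Real.log (2 * R₂ / ‖x‖) ^ μ)) D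
      (by fun_prop) ?_).trans (by gcongr)
    · filter_upwards [hu0] with x hx hxS
      exact hx (by simpa using hxS.1)
    · rintro j x ⟨h1, h2⟩
      refine ⟨by push_cast; exact h1, h2.trans_le ?_⟩
      push_cast
      rw [← mul_assoc]
      gcongr
      rw [show ρ ^ 2 = ρ ^ (2 : ℤ) by norm_cast, ← zpow_add₀ hρ0.ne']
      exact zpow_le_zpow_right₀ hρ.le (by omega)
    · filter_upwards [hu0, hne] with x hx hx0 hxT
      by_contra hux
      have hxR : ‖x‖ < R₂ := lt_of_not_ge fun h => hux (hx h)
      obtain ⟨j, hj⟩ := exists_zpow_neg_of_lt hρ hR₂ (norm_pos_iff.2 hx0) hxR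
      exact hxT (Set.mem_iUnion.2 ⟨j, hj⟩)
    · rintro j x ⟨h1, h2⟩
      push_cast
      have hx0 : 0 < ‖x‖ := lt_of_lt_of_le (by positivity) h1
      refine ofReal_rpow_div_log_rpow_le hγ hρ (by linarith) (by positivity) h1 ?_
      rw [le_div_iff₀ hx0]
      rw [zpow_neg, zpow_natCast] at h2
      have : ρ ^ j * ‖x‖ ≤ ρ ^ j * ((ρ ^ j)⁻¹ * R₂) := by gcongr
      rw [mul_inv_cancel_left₀ (by positivity)] at this
      linarith
  · have hu0 : ∀ᵐ x, ‖x‖ < R₁ → u x = 0 := by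
      filter_upwards [hsupp] with x hx hxR
      refine hx fun h => ?_
      have : x ∈ essSupport u ∩ Metric.ball 0 R₁ := ⟨h, by simpa using hxR⟩
      rw [hS] at this
      exact this
    have ek : ∀ j : ℕ, (((j + 1 : ℕ) : ℤ) - 2) = (j : ℤ) - 1 := fun j => by push_cast; ring
    have hle : ∀ j : ℕ, ρ ^ ((j : ℤ) - 1) * R₁ ≤ ρ ^ j * R₁ := fun j => by
      gcongr
      rw [← zpow_natCast]
      exact zpow_le_zpow_right₀ hρ.le (by omega)
    -- Walk outwards from index -2, since the shell ρ^(-2)R₁ ≤ |x| < R₁ of ratio ρ² just fits inside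
    -- the ball where u vanishes. The set T j is then the outer part of the shell of index j - 1.
    refine (H R₁ hR₁ u hum (fun j => (j : ℤ) - 2) (fun i j h => by simpa using h)
      (fun j => Or.inl (by push_cast; ring)) ?_
      (fun j => normShell d (ρ ^ j * R₁) (ρ ^ (j + 1) * R₁))
      (fun j => measurableSet_normShell _ _ _) ?_ ?_
      (fun x => ENNReal.ofReal (‖x‖ ^ (γ * τ) / Real.log (2 * ‖x‖ / R₁) ^ μ)) D
      (by fun_prop) ?_).trans (by gcongr)
    · filter_upwards [hu0] with x hx hxS
      refine hx (hxS.2.trans_eq ?_)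
      rw [← mul_assoc, show ρ ^ 2 = ρ ^ (2 : ℤ) by norm_cast, ← zpow_add₀ hρ0.ne']
      simp
    · rintro j x ⟨h1, h2⟩
      rw [ek]
      refine ⟨(hle j).trans h1, h2.trans_eq ?_⟩
      rw [← mul_assoc, show ρ ^ 2 = ρ ^ (2 : ℤ) by norm_cast, ← zpow_add₀ hρ0.ne',
        ← zpow_natCast]
      congr 2
      push_cast
      ring
    · filter_upwards [hu0] with x hx hxT
      by_contra hux
      have hxR : R₁ ≤ ‖x‖ := le_of_not_gt fun h => hux (hx h)
      obtain ⟨j, hj⟩ := exists_pow_of_le hρ hR₁ hxR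
      exact hxT (Set.mem_iUnion.2 ⟨j, hj⟩)
    · rintro j x ⟨h1, h2⟩
      rw [ek]
      refine ofReal_rpow_div_log_rpow_le hγ hρ (by linarith) (by positivity)
        ((hle j).trans h1) ?_
      rw [le_div_iff₀ hR₁]
      linarith
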